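/- **Setting.** Let $N\ge 1$, $m\ge 0$. Consider the problem of minimizing $\frac1N\sum_{i=1}^N f_i(x_i)$ subject to $\frac1N\sum_{i=1}^N A_ix_i\le b$, $x_i\in\operatorname{dom}(f_i)$, where $A_i\in\mathbb R^{m\times d_i}$, $b\in\mathbb R^m$, and each $f_i:\mathbb R^{d_i}\to\mathbb R\cup\{+\infty\}$ is closed, proper, has an affine minorant, and has a compact convex domain ($f_i$ need not be convex). Put $h_i=f_i^{**}$ and $X_i=\operatorname{conv}(\operatorname{dom} f_i)$; the bidual is the same problem with $h_i,X_i$ in place of $f_i,\operatorname{dom} f_i$, and the dual function is $$d(\lambda)=-\lambda^\top b+\frac1N\sum_{i=1}^N\inf_{x\in X_i}\{h_i(x)+\lambda^\top A_ix\}.$$ Assume that $d$ has a maximizer $\lambda^*$ over $\mathbb R^m_+$ and that $d^*=d(\lambda^*)$ is also the optimal value of the bidual. Let $\tilde G=\sup_{i,\,x\in X_i}\|A_ix-b\|$, $H=\sup_{i,\,x\in X_i}|h_i(x)|$ (assumed finite), $\|v\|_+=(\sum_j\max(v_j,0)^2)^{1/2}$, $[v]_+=(\max(v_j,0))_j$,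 and $$\rho(f_i)=\sup\Big\{f_i\Big(\sum_{j=1}^p\alpha_jx^j\Big)-\sum_{j=1}^p\alpha_jf_i(x^j)\;:\;p\in\mathbb N,\ x^j\in\operatorname{dom} f_i,\ \alpha\ge0,\ \sum_j\alpha_j=1\Big\}\in[0,+\infty].$$ An oracle is given: for $\gamma\ge0$, $\lambda\in\mathbb R^m$ it returns $x_i^*(\gamma,\lambda)\in\operatorname{argmin}_{x\in X_i}\{\gamma h_i(x)+\lambda^\top A_ix\}$ that lies in $\operatorname{dom}(f_i)$ and satisfies $f_i(x_i^*(\gamma,\lambda))=f_i^{**}(x_i^*(\gamma,\lambda))$. Write $x_i^*(\lambda)=x_i^*(1,\lambda)$. Let $\Lambda>0$ and let $T,K\ge1$ be integers. **Algorithm.** *Stage 1.* Put $\lambda_0=0$, $\alpha=\Lambda/(\tilde G\sqrt T)$. For $t=0,\dots,T-2$ sample $i_t\in\{1,\dots,N\}$ uniformly and independently and set $\lambda_{t+1}=[\lambda_t+\alpha(A_{i_t}x_{i_t}^*(\lambda_t)-b)]_+$. In the last step compute $x_i^*(\lambda_{T-1})$ for all $i$ and set $\lambda_T=[\lambda_{T-1}+\alpha(\frac1N\sum_iA_ix_i^*(\lambda_{T-1})-b)]_+$.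 Put $\bar\lambda_T=\frac1T\sum_{t<T}\lambda_t$. *Start of stage 2.* Let $I_i=\#\{t\le T-2:i_t=i\}$, $$\beta_i^0=\frac{1}{N(I_i+1)}\Big(h_i(x_i^*(\lambda_{T-1}))+\sum_{t\le T-2,\,i_t=i}h_i(x_i^*(\lambda_t))\Big),\qquad z_i^0=\frac{1}{N(I_i+1)}A_i\Big(x_i^*(\lambda_{T-1})+\sum_{t\le T-2,\,i_t=i}x_i^*(\lambda_t)\Big).$$ *Stage 2 (block-coordinate Frank–Wolfe).* For $k=0,\dots,K-1$ put $\beta^k=\sum_i\beta_i^k$, $z^k=\sum_iz_i^k$, $\gamma^k=\max(\beta^k-d(\bar\lambda_T),0)$, $g^k=[z^k-b]_+$, sample $i=i_k$ uniformly and independently, let $x=x_i^*(\gamma^k,g^k)$, $\rho_k=\frac{2N}{k+2N}$, and replace $(\beta_i^k,z_i^k)$ by $(1-\rho_k)(\beta_i^k,z_i^k)+\frac{\rho_k}{N}(h_i(x),A_ix)$, leaving the other blocks unchanged. Let $(\beta^K,z^K)$ be the final sums. *Decomposition and reconstruction.* For each $i$ let $(x_i^l)_{l\in Q_i}$ be the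 finite family of starting points and oracle answers computed for index $i$ (those averaged in the start of stage 2, and those of stage 2). Take any conic Carathéodory decomposition $$(\beta^K,z^K,\mathbf 1_N)=\sum_{i=1}^N\sum_{l\in Q_i}\tilde\omega_i^l\Big(\tfrac1Nf_i(x_i^l),\tfrac1NA_ix_i^l,e_i\Big),\qquad\tilde\omega_i^l\ge0,$$ with at most $1+m+N$ nonzero coefficients, and put $\bar x_i=\sum_{l\in Q_i}\tilde\omega_i^lx_i^l$ (which is just one of the points $x_i^l$ when only one coefficient of $i$ is nonzero). **Theorem.** 1. Such a decomposition exists for every outcome of the sampling. Whichever is chosen, $\bar x_i\in\operatorname{dom}(f_i)$ for all $i$, and there is a constant $C$ depending only on $\tilde G,H,\|\lambda^*\|,\Lambda$ (in particular not on $N,m,T,K$) such that, for all $T,K\ge1$, $$\mathbb E\Big[\frac1N\sum_{i=1}^Nf_i(\bar x_i)-d^*\Big]\le\frac{m+1}{N}\max_i\rho(f_i)+C\Big(\frac1{\sqrt T}+\frac1{\sqrt K}+\frac NK\Big(\sqrt{\frac NT}+\frac NT\Big)\Big),$$ $$\mathbb E\Big\|\frac1N\sum_{i=1}^NA_i\bar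 x_i-b\Big\|_+\le C\Big(\frac1{\sqrt T}+\frac1{\sqrt K}+\frac NK\Big(\sqrt{\frac NT}+\frac NT\Big)\Big).$$ 2. For every $\varepsilon_0>0$ there is a constant $C'$ depending only on $\varepsilon_0,\tilde G,H,\|\lambda^*\|,\Lambda$ such that for every $0<\varepsilon\le\varepsilon_0$ one can choose $T=K$ so that the two expectations are at most $\frac{m+1}{N}\max_i\rho(f_i)+\varepsilon$ and $\varepsilon$ respectively, with at most $C'\big(\frac1{\varepsilon^2}+\frac N{\varepsilon^{2/3}}\big)$ oracle calls in total (including $N$ calls for evaluating $d(\bar\lambda_T)$; the computation of the decomposition is not counted). 3. If stage 2 is started instead from $\beta_i^0=\frac1Nh_i(x_i^0)$, $z_i^0=\frac1NA_ix_i^0$ with arbitrary $x_i^0\in\operatorname{dom}(f_i)$ such that $f_i(x_i^0)=f_i^{**}(x_i^0)$, then 1 and 2 hold with constants $C,C'$ that may in addition depend on $N$. -/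

import Mathlib

noncomputable section

namespace SepOpt

/-- Euclidean space `ℝⁿ`. -/
abbrev Vec (n : ℕ) : Type := EuclideanSpace ℝ (Fin n)

/-- Effective domain of an extended-real-valued function. -/
def dom {n : ℕ} (f : Vec n → EReal) : Set (Vec n) := {x | f x < ⊤}

/-- Fenchel conjugate `f*(y) = sup_x (yᵀx - f x)` (points with `f x = ⊤` contribute `⊥`). -/
def conj {n : ℕ} (f : Vec n → EReal) (y : Vec n) : EReal :=
  ⨆ x : Vec n, ((inner ℝ y x : ℝ) : EReal) - f x

/-- Biconjugate `f**`. -/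
def biconj {n : ℕ} (f : Vec n → EReal) : Vec n → EReal := conj (conj f)

/-- Nonconvexity of `f`: the supremum of `f (∑ αⱼ xⱼ) - ∑ αⱼ f (xⱼ)` over all finite convex
combinations of points of the domain.  It may be `⊤`. -/
def rho {n : ℕ} (f : Vec n → EReal) : EReal :=
  sSup {r : EReal | ∃ (p : ℕ) (α : Fin p → ℝ) (x : Fin p → Vec n),
    (∀ j, 0 ≤ α j) ∧ ∑ j, α j = 1 ∧ (∀ j, x j ∈ dom f) ∧
    r = f (∑ j, α j • x j) - ((∑ j, α j * (f (x j)).toReal : ℝ) : EReal)}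

/-- Projection onto the nonnegative orthant. -/
def projPos {m : ℕ} (v : Vec m) : Vec m := WithLp.toLp 2 (fun j => max (v j) 0)

/-- `‖v‖₊ = (∑ⱼ max(vⱼ, 0)²)^(1/2)`. -/
def normPlus {m : ℕ} (v : Vec m) : ℝ := Real.sqrt (∑ j, max (v j) 0 ^ 2)

/-- Data of the separable problem: minimize `(1/N) ∑ fᵢ(xᵢ)` subject to
`(1/N) ∑ Aᵢ xᵢ ≤ b`, `xᵢ ∈ dom fᵢ`. -/
structure Problem (N m : ℕ) where
  dim : Fin N → ℕ
  f : (i : Fin N) → Vec (dim i) → EReal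
  A : (i : Fin N) → Vec (dim i) →L[ℝ] Vec m
  b : Vec m

namespace Problem

variable {N m : ℕ} (P : Problem N m)

/-- Every `fᵢ` is proper, closed, has an affine minorant, and its domain is compact and convex. -/
structure Admissible : Prop where
  ne_bot : ∀ i x, P.f i x ≠ ⊥
  nonempty_dom : ∀ i, (dom (P.f i)).Nonempty
  closed : ∀ i, LowerSemicontinuous (P.f i)
  affine_minorant : ∀ i, ∃ (a : Vec (P.dim i)) (c : ℝ),
    ∀ x, ((inner ℝ a x + c : ℝ) : EReal) ≤ P.f i x
  compact_dom : ∀ i, IsCompact (dom (P.f i))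
  convex_dom : ∀ i, Convex ℝ (dom (P.f i))

/-- `X i = conv (dom fᵢ)`, the domain of the `i`-th function of the bidual problem. -/
def X (i : Fin N) : Set (Vec (P.dim i)) := convexHull ℝ (dom (P.f i))

/-- Real value of `fᵢ`, used only at points of `dom fᵢ`, where `fᵢ` is finite. -/
def fval (i : Fin N) (x : Vec (P.dim i)) : ℝ := (P.f i x).toReal

/-- Real value of `fᵢ**`, used only on `X i`, where `fᵢ**` is finite. -/
def hval (i : Fin N) (x : Vec (P.dim i)) : ℝ := (biconj (P.f i) x).toReal

/-- The dual function `d(λ) = -λᵀb + (1/N) ∑ᵢ inf_{x ∈ Xᵢ} (fᵢ**(x) + λᵀAᵢx)`. -/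
def dual (lam : Vec m) : ℝ :=
  -inner ℝ lam P.b + (1 / (N : ℝ)) *
    ∑ i, sInf ((fun x => P.hval i x + inner ℝ lam (P.A i x)) '' P.X i)

/-- `λ` maximizes the dual function over the nonnegative orthant. -/
def IsDualSolution (lam : Vec m) : Prop :=
  (∀ j, 0 ≤ lam j) ∧ ∀ mu : Vec m, (∀ j, 0 ≤ mu j) → P.dual mu ≤ P.dual lam

/-- `v` is the optimal value of the bidual problem: minimize `(1/N) ∑ fᵢ**(xᵢ)` subject to
`(1/N) ∑ Aᵢ xᵢ ≤ b`, `xᵢ ∈ conv (dom fᵢ)`. (In particular that problem is feasible, as `∅` has no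
greatest lower bound in `ℝ`.) -/
def IsBidualValue (v : ℝ) : Prop :=
  IsGLB {r : ℝ | ∃ x : (i : Fin N) → Vec (P.dim i), (∀ i, x i ∈ P.X i) ∧
    (∀ j, ((1 / (N : ℝ)) • ∑ i, P.A i (x i)) j ≤ P.b j) ∧
    r = (1 / (N : ℝ)) * ∑ i, P.hval i (x i)} v

/-- `G̃ = sup_{i, x ∈ Xᵢ} ‖Aᵢ x - b‖`. -/
def Gt : ℝ := sSup {r : ℝ | ∃ i, ∃ x ∈ P.X i, r = ‖P.A i x - P.b‖}

/-- The numbers `|fᵢ**(x)|`, for `i = 1, …, N` and `x ∈ Xᵢ`. -/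
def absValues : Set ℝ := {r : ℝ | ∃ i, ∃ x ∈ P.X i, r = |P.hval i x|}

/-- `H = sup_{i, x ∈ Xᵢ} |fᵢ**(x)|`. -/
def H : ℝ := sSup P.absValues

/-- A minimization oracle for the bidual: for `γ ≥ 0` and `λ ∈ ℝᵐ` it returns a minimizer of
`γ fᵢ**(x) + λᵀAᵢx` over `Xᵢ` that lies in `dom fᵢ` and at which `fᵢ` and `fᵢ**` agree. -/
def IsOracle (orc : (i : Fin N) → ℝ → Vec m → Vec (P.dim i)) : Prop :=
  ∀ i (γ : ℝ) (lam : Vec m), 0 ≤ γ →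
    orc i γ lam ∈ dom (P.f i) ∧
    IsMinOn (fun x => γ * P.hval i x + inner ℝ lam (P.A i x)) (P.X i) (orc i γ lam) ∧
    P.f i (orc i γ lam) = biconj (P.f i) (orc i γ lam)

/-- How the second stage is started: from the averages of the first-stage oracle answers and of
their function values, or from prescribed points. -/
inductive Start where
  | averages : Start
  | points : ((i : Fin N) → Vec (P.dim i)) → Start

/-- Input of the two-stage algorithm. -/
structure Algo where
  orc : (i : Fin N) → ℝ → Vec m → Vec (P.dim i)
  lam0 : Vec m
  α : ℕ → ℝ
  T : ℕ
  K : ℕ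
  start : P.Start

end Problem

/-- State of the first stage: the dual iterate and the number of oracle calls made so far. -/
structure Stage1State (m : ℕ) where
  lam : Vec m
  calls : ℕ

/-- State of the second stage: the pairs `(βᵢ, zᵢ)` and the number of oracle calls made so far. -/
structure Stage2State (N m : ℕ) where
  β : Fin N → ℝ
  z : Fin N → Vec m
  calls : ℕ

namespace Problem.Algo

variable {N m : ℕ} {P : Problem N m} (a : P.Algo)

/-- Random choices of one run: the indices `i₀, …, i_{T-2}` sampled by the first stage and the
indices `i₀, …, i_{K-1}` sampled by the second stage.  The sampled indices are independent and
uniform, that is, the law of a run is uniform on this finite type. -/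
abbrev Sample : Type := (Fin (a.T - 1) → Fin N) × (Fin a.K → Fin N)

/-- Expectation over the random choices of a run. -/
def expect (Y : a.Sample → ℝ) : ℝ := Finset.expect Finset.univ Y

/-- Stage 1, stochastic dual subgradient: `T - 1` steps with one sampled index (one oracle call)
each, then a step with the full subgradient (`N` oracle calls). -/
def stage1 (ω : a.Sample) : ℕ → Stage1State m
  | 0 => ⟨a.lam0, 0⟩
  | t + 1 =>
    let s := stage1 ω t
    if h : t < a.T - 1 then
      let i := ω.1 ⟨t, h⟩
      ⟨projPos (s.lam + a.α t • (P.A i (a.orc i 1 s.lam) - P.b)), s.calls + 1⟩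
    else
      ⟨projPos (s.lam + a.α t • ((1 / (N : ℝ)) • ∑ i, P.A i (a.orc i 1 s.lam) - P.b)),
        s.calls + N⟩

/-- The dual iterate `λ_t`. -/
def lam (ω : a.Sample) (t : ℕ) : Vec m := (a.stage1 ω t).lam

/-- The averaged dual iterate `(1/T) ∑_{t < T} λ_t`. -/
def lamBar (ω : a.Sample) : Vec m := (1 / (a.T : ℝ)) • ∑ t ∈ Finset.range a.T, a.lam ω t

/-- Number of times that the first stage samples the index `i`. -/
def count (ω : a.Sample) (i : Fin N) : ℕ := (Finset.univ.filter fun t => ω.1 t = i).card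

/-- Points with which the second stage starts. For the start from averages, `none` stands for the
answer at the last step `T - 1` of the first stage and `some t` for the answer at step `t`. -/
def startPt (ω : a.Sample) (i : Fin N) (l : Option (Fin (a.T - 1))) : Vec (P.dim i) :=
  match a.start with
  | .averages =>
    match l with
    | none => a.orc i 1 (a.lam ω (a.T - 1))
    | some t => a.orc i 1 (a.lam ω t)
  | .points x0 => x0 i

/-- Initial value `βᵢ⁰` of the second stage. -/
def β0 (ω : a.Sample) (i : Fin N) : ℝ :=
  match a.start with
  | .averages => (1 / ((a.count ω i : ℝ) + 1)) *
      ((1 / (N : ℝ)) * P.hval i (a.orc i 1 (a.lam ω (a.T - 1))) +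
        ∑ t with ω.1 t = i, (1 / (N : ℝ)) * P.hval i (a.orc i 1 (a.lam ω t)))
  | .points x0 => (1 / (N : ℝ)) * P.hval i (x0 i)

/-- Initial value `zᵢ⁰` of the second stage. -/
def z0 (ω : a.Sample) (i : Fin N) : Vec m :=
  match a.start with
  | .averages => (1 / (N : ℝ)) • P.A i ((1 / ((a.count ω i : ℝ) + 1)) •
      (a.orc i 1 (a.lam ω (a.T - 1)) + ∑ t with ω.1 t = i, a.orc i 1 (a.lam ω t)))
  | .points x0 => (1 / (N : ℝ)) • P.A i (x0 i)

/-- First component of the gradient of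
`F(β, z) = ½ max(β - d(λ̄_T), 0)² + ½ ‖z - b‖₊²` at the current state. -/
def gradβ (ω : a.Sample) (s : Stage2State N m) : ℝ :=
  max (∑ i, s.β i - P.dual (a.lamBar ω)) 0

/-- Second component of that gradient. -/
def gradz (s : Stage2State N m) : Vec m := projPos (∑ i, s.z i - P.b)

/-- Stage 2, block-coordinate Frank-Wolfe with step sizes `2N/(k + 2N)`; one oracle call for each
iteration. -/
def stage2 (ω : a.Sample) : ℕ → Stage2State N m
  | 0 => ⟨a.β0 ω, a.z0 ω, 0⟩
  | k + 1 =>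
    let s := stage2 ω k
    if h : k < a.K then
      let i := ω.2 ⟨k, h⟩
      let x := a.orc i (a.gradβ ω s) (gradz (P := P) s)
      let r : ℝ := 2 * N / (k + 2 * N)
      ⟨Function.update s.β i ((1 - r) * s.β i + r * ((1 / (N : ℝ)) * P.hval i x)),
        Function.update s.z i ((1 - r) • s.z i + r • ((1 / (N : ℝ)) • P.A i x)),
        s.calls + 1⟩
    else s

/-- The output `βᴷ` of the second stage. -/
def βK (ω : a.Sample) : ℝ := ∑ i, (a.stage2 ω a.K).β i

/-- The output `zᴷ` of the second stage. -/
def zK (ω : a.Sample) : Vec m := ∑ i, (a.stage2 ω a.K).z i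

/-- Number of oracle calls of a run: those of the `T` steps of the first stage, `N` calls for the
evaluation of `d(λ̄_T)`, and those of the `K` iterations of the second stage. -/
def totalCalls (ω : a.Sample) : ℕ :=
  (a.stage1 ω a.T).calls + N + (a.stage2 ω a.K).calls

/-- Labels of the points that are available for the final decomposition: starting points of the
second stage and answers of the oracle during the second stage. -/
abbrev Label : Type := Option (Fin (a.T - 1)) ⊕ Fin a.K

/-- The point `xᵢˡ`. -/
def pt (ω : a.Sample) (i : Fin N) : a.Label → Vec (P.dim i)
  | .inl l => a.startPt ω i l
  | .inr k => a.orc i (a.gradβ ω (a.stage2 ω k)) (gradz (P := P) (a.stage2 ω k))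

/-- The set `Qᵢ` of labels of the points that the run has produced for the index `i`. -/
def Q (ω : a.Sample) (i : Fin N) : Set a.Label :=
  {l | match l with
    | .inl none => True
    | .inl (some t) => a.start = .averages ∧ ω.1 t = i
    | .inr k => ω.2 k = i}

/-- `w` is a conic Carathéodory decomposition of `(βᴷ, zᴷ, 1_N) ∈ ℝ^{1+m+N}`:
a conic combination of the vectors `((1/N) fᵢ(xᵢˡ), (1/N) Aᵢ xᵢˡ, eᵢ)`, `l ∈ Qᵢ`, with at most
`1 + m + N` nonzero coefficients. -/
structure IsCaratheodory (ω : a.Sample) (w : Fin N → a.Label → ℝ) : Prop where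
  nonneg : ∀ i l, 0 ≤ w i l
  eq_zero : ∀ i l, l ∉ a.Q ω i → w i l = 0
  sum_β : ∑ i, ∑ l, w i l * ((1 / (N : ℝ)) * P.fval i (a.pt ω i l)) = a.βK ω
  sum_z : ∑ i, ∑ l, w i l • ((1 / (N : ℝ)) • P.A i (a.pt ω i l)) = a.zK ω
  sum_one : ∀ i, ∑ l, w i l = 1
  card_le : {q : Fin N × a.Label | w q.1 q.2 ≠ 0}.ncard ≤ 1 + m + N

/-- `x̄` is the final point built from some conic Carathéodory decomposition:
`x̄ᵢ = ∑_l wᵢˡ xᵢˡ`.  (If only one coefficient of the index `i` is nonzero, it equals one and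
`x̄ᵢ` is the corresponding point `xᵢˡ`.) -/
def IsOutput (ω : a.Sample) (xbar : (i : Fin N) → Vec (P.dim i)) : Prop :=
  ∃ w, a.IsCaratheodory ω w ∧ ∀ i, xbar i = ∑ l, w i l • a.pt ω i l

/-- The guarantee with optimal dual value `v` and error `e`.  Every run has an output; and whichever
outputs `x̄` are chosen, `x̄ᵢ ∈ dom fᵢ`, the expected suboptimality is at most
`((m+1)/N) maxᵢ ρ(fᵢ) + e`, and the expected infeasibility is at most `e`. -/
def Guarantee (v e : ℝ) : Prop :=
  (∀ ω, ∃ xbar, a.IsOutput ω xbar) ∧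
  ∀ xbar : a.Sample → (i : Fin N) → Vec (P.dim i), (∀ ω, a.IsOutput ω (xbar ω)) →
    (∀ ω i, xbar ω i ∈ dom (P.f i)) ∧
    (((a.expect fun ω => (1 / (N : ℝ)) * ∑ i, P.fval i (xbar ω i) - v) : ℝ) : EReal) ≤
      ((((m : ℝ) + 1) / (N : ℝ) : ℝ) : EReal) * (⨆ i, rho (P.f i)) + (e : EReal) ∧
    (a.expect fun ω => normPlus ((1 / (N : ℝ)) • ∑ i, P.A i (xbar ω i) - P.b)) ≤ e

end Problem.Algo

/-- The two-stage algorithm with `λ₀ = 0` and constant step size `Λ / (G̃ √T)`. -/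
def twoStage {N m : ℕ} (P : Problem N m) (orc : (i : Fin N) → ℝ → Vec m → Vec (P.dim i))
    (Λ : ℝ) (T K : ℕ) (start : P.Start) : P.Algo where
  orc := orc
  lam0 := 0
  α := fun _ => Λ / (P.Gt * Real.sqrt T)
  T := T
  K := K
  start := start

/-- `1/√T + 1/√K + (N/K) (√(N/T) + N/T)`. -/
def rate (N T K : ℕ) : ℝ :=
  1 / Real.sqrt T + 1 / Real.sqrt K + (N : ℝ) / K * (Real.sqrt ((N : ℝ) / T) + (N : ℝ) / T)

/-- `1/ε² + N/ε^{2/3}`. -/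
def complexity (N : ℕ) (ε : ℝ) : ℝ := 1 / ε ^ 2 + (N : ℝ) / ε ^ (2 / 3 : ℝ)

end SepOpt

end

open SepOpt

/-!
The first stage is a stochastic supergradient method for the dual problem, the second one a
block-coordinate Frank-Wolfe method for
`F(β, z) = ½ max(β - d(λ̄), 0)² + ½ ‖z - b‖₊²` over the product of the convex hulls of the pairs
`(hᵢ(x)/N, Aᵢ x/N)`.  The root of `2F` at the final state bounds both the suboptimality and the
infeasibility of `(βᴷ, zᴷ)`, because `d(λ̄) ≤ d*`; so it suffices to bound its expectation
(`guarantee_of_expect_sqrt_objective_le`).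

* Near-optimal points of the bidual problem show that the infimum of `2F` is at most
  `(d* - d(λ̄))²`.  The oracle minimizes the linearization of `F` in each block, and `F` is convex
  and smooth, so conditionally on the first stage the expected value of `2F` after `K` steps is at
  most `(d* - d(λ̄))² + (2N/K)² 2F(β⁰, z⁰) + 16 (H² + G̃²)/K`.  Jensen's inequality for the root
  gives `expect_sqrt_objective_le`.
* The usual telescoping argument gives `𝔼 (d* - d(λ̄)) = O(1/√T)` (`expect_dual_gap_le`) and bounds
  the second moments of the dual iterates (`expect_norm_lam_sq_le`).
* For the start from averages, the root of `2F` is small already at the start: the averages of the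
  function values and residuals over all steps of the first stage exceed `d(λ̄)` and feasibility by
  `O(1/√T)` only (`expect_sampled_val_sub_dual_le`, `expect_normPlus_avg_stepDir_le`; the former
  uses that the sampling noise is a martingale).  The blockwise averages `(β⁰, z⁰)` differ from them
  by the deviation of the sampling frequencies, which is binomial
  (`norm_blockAvg_sub_le`, `expect_deviation_le`).
* Every state of the second stage is a convex combination, block by block, of the points produced so
  far (`isBlockCombination_stage2`), so Carathéodory's theorem for cones provides a decomposition.
  As every block has a nonzero coefficient, at most `m + 1` blocks have several, and only these pay
  their nonconvexity `ρ(fᵢ)` (`IsCaratheodory.avg_fval_le`).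

Expectations are averages over a finite product; independence of the samples enters only through
`expect_resample`.  If `G̃ = 0`, then the step size is the junk value `Λ/0 = 0`; all residuals
vanish in that case, and the bounds of the first stage hold trivially.
-/

namespace SepOpt

open Finset
open scoped BigOperators

/-! ### Finite expectations -/

/-- Resampling one coordinate: `upd ω j` replaces the coordinate `c ω` by `j`.  If `Φ ω` does not
depend on that coordinate, then evaluating `Φ ω` at it amounts, in expectation, to averaging. -/
theorem expect_resample {Ω ι : Type*} [Fintype Ω] [Fintype ι] [Nonempty ι]
    (upd : Ω → ι → Ω) (c : Ω → ι) (h1 : ∀ ω j, c (upd ω j) = j)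
    (h2 : ∀ ω j, upd (upd ω j) (c ω) = ω) (Φ : Ω → ι → ℝ) (hΦ : ∀ ω j, Φ (upd ω j) = Φ ω) :
    Finset.expect univ (fun ω => Φ ω (c ω)) =
      Finset.expect univ fun ω => Finset.expect univ (Φ ω) := by
  have key : Finset.expect univ (fun q : Ω × ι => Φ q.1 (c q.1)) =
      Finset.expect univ fun q : Ω × ι => Φ q.1 q.2 := by
    refine Finset.expect_nbij' (fun q => (upd q.1 q.2, c q.1)) (fun q => (upd q.1 q.2, c q.1))
      (by simp) (by simp) ?_ ?_ ?_
    · rintro ⟨ω, j⟩ -; simp [h1, h2]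
    · rintro ⟨ω, j⟩ -; simp [h1, h2]
    · rintro ⟨ω, j⟩ -; simp [hΦ]
  rw [← univ_product_univ, expect_product, expect_product] at key
  simpa using key

/-- Resampling a coordinate of the first factor of a product. -/
theorem expect_resample_fst {n : ℕ} {ι κ : Type*} [Fintype ι] [Nonempty ι] [Fintype κ]
    (t : Fin n) (Φ : (Fin n → ι) × κ → ι → ℝ)
    (hΦ : ∀ ω j, Φ (Function.update ω.1 t j, ω.2) = Φ ω) :
    Finset.expect univ (fun ω => Φ ω (ω.1 t)) =
      Finset.expect univ fun ω => Finset.expect univ (Φ ω) :=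
  expect_resample (fun ω j => (Function.update ω.1 t j, ω.2)) (fun ω => ω.1 t)
    (by simp) (by simp) Φ hΦ

theorem expect_resample_pi {n : ℕ} {ι : Type*} [Fintype ι] [Nonempty ι]
    (t : Fin n) (Φ : (Fin n → ι) → ι → ℝ) (hΦ : ∀ ω j, Φ (Function.update ω t j) = Φ ω) :
    Finset.expect univ (fun ω => Φ ω (ω t)) =
      Finset.expect univ fun ω => Finset.expect univ (Φ ω) :=
  expect_resample (fun ω j => Function.update ω t j) (fun ω => ω t) (by simp) (by simp) Φ hΦ

theorem sq_expect_le {Ω : Type*} [Fintype Ω] [Nonempty Ω] (f : Ω → ℝ) :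
    (Finset.expect univ f) ^ 2 ≤ Finset.expect univ fun ω => f ω ^ 2 := by
  simpa using Finset.expect_mul_sq_le_sq_mul_sq univ f (fun _ => (1 : ℝ))

/-- Jensen's inequality for the square root. -/
theorem expect_le_sqrt {Ω : Type*} [Fintype Ω] [Nonempty Ω] {f : Ω → ℝ} {c : ℝ}
    (h : (Finset.expect univ fun ω => f ω ^ 2) ≤ c) : Finset.expect univ f ≤ √c :=
  Real.le_sqrt_of_sq_le ((sq_expect_le f).trans h)

/-- The second moment of a sum of martingale differences `X t ω (ω t) - 𝔼 j, X t ω j`, where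
`X t ω` depends only on the coordinates of `ω` before `t`. -/
theorem expect_sq_sum_sub_expect_le {n : ℕ} {ι κ : Type*} [Fintype ι] [Nonempty ι] [Fintype κ]
    (X : Fin n → (Fin n → ι) × κ → ι → ℝ)
    (hX : ∀ t s, t ≤ s → ∀ ω j, X t (Function.update ω.1 s j, ω.2) = X t ω) :
    (Finset.expect univ fun ω : (Fin n → ι) × κ =>
        (∑ t, (X t ω (ω.1 t) - Finset.expect univ (X t ω))) ^ 2) ≤
      ∑ t, Finset.expect univ fun ω => Finset.expect univ fun j => X t ω j ^ 2 := by
  classical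
  set D : Fin n → (Fin n → ι) × κ → ℝ := fun t ω => X t ω (ω.1 t) - Finset.expect univ (X t ω)
    with hD
  have hDinv : ∀ s t, s < t → ∀ ω j, D s (Function.update ω.1 t j, ω.2) = D s ω := by
    intro s t hst ω j
    simp only [hD, hX s t hst.le]
    rw [Function.update_of_ne hst.ne]
  -- differences at distinct times are uncorrelated
  have hlt : ∀ s t, s < t → (Finset.expect univ fun ω => D s ω * D t ω) = 0 := by
    intro s t hst
    have := expect_resample_fst t
      (fun ω i => D s ω * (X t ω i - Finset.expect univ (X t ω)))
      (by intro ω j; simp only [hDinv s t hst, hX t t le_rfl])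
    rw [hD] at this ⊢
    rw [this]
    refine expect_eq_zero fun ω _ => ?_
    rw [← mul_expect, expect_sub_distrib]
    simp
  have hdiag : ∀ t, (Finset.expect univ fun ω => D t ω * D t ω) ≤
      Finset.expect univ fun ω => Finset.expect univ fun j => X t ω j ^ 2 := by
    intro t
    have := expect_resample_fst t
      (fun ω i => (X t ω i - Finset.expect univ (X t ω)) *
        (X t ω i - Finset.expect univ (X t ω)))
      (by intro ω j; simp only [hX t t le_rfl])
    rw [hD, this]
    refine expect_le_expect fun ω _ => ?_
    have e : ∀ i, (X t ω i - Finset.expect univ (X t ω)) *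
        (X t ω i - Finset.expect univ (X t ω)) =
        X t ω i ^ 2 - 2 * Finset.expect univ (X t ω) * X t ω i
          + Finset.expect univ (X t ω) ^ 2 := fun i => by ring
    simp only [e]
    rw [expect_add_distrib, expect_sub_distrib, ← mul_expect, Fintype.expect_const]
    nlinarith [sq_nonneg (Finset.expect univ (X t ω))]
  calc _ = Finset.expect univ fun ω => ∑ s, ∑ t, D s ω * D t ω := by
        refine expect_congr rfl fun ω _ => ?_
        rw [sq, sum_mul_sum]
    _ = ∑ s, ∑ t, Finset.expect univ fun ω => D s ω * D t ω := by
        rw [expect_sum_comm]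
        exact sum_congr rfl fun s _ => expect_sum_comm _ _ _
    _ = ∑ s, Finset.expect univ fun ω => D s ω * D s ω := by
        refine sum_congr rfl fun s _ => sum_eq_single s (fun t _ hts => ?_) (by simp)
        rcases lt_or_gt_of_ne hts with h | h
        · rw [← hlt t s h]; exact expect_congr rfl fun ω _ => mul_comm _ _
        · exact hlt s t h
    _ ≤ _ := sum_le_sum fun t _ => hdiag t

/-! ### Conic combinations -/

/-- Carathéodory's theorem for conic combinations. -/
theorem exists_conic_card_le_finrank {I V : Type*} [Fintype I] [AddCommGroup V] [Module ℝ V]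
    [FiniteDimensional ℝ V] (v : I → V) (w : I → ℝ) (hw : ∀ i, 0 ≤ w i) :
    ∃ w' : I → ℝ, (∀ i, 0 ≤ w' i) ∧ (∀ i, w i = 0 → w' i = 0) ∧
      ∑ i, w' i • v i = ∑ i, w i • v i ∧
      (univ.filter fun i => w' i ≠ 0).card ≤ Module.finrank ℝ V := by
  classical
  induction hn : (univ.filter fun i => w i ≠ 0).card using Nat.strong_induction_on generalizing w
    with
  | _ n ih =>
  by_cases hli : LinearIndepOn ℝ v {i | w i ≠ 0}
  · refine ⟨w, hw, fun _ h => h, rfl, ?_⟩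
    have h := LinearIndependent.fintype_card_le_finrank (R := ℝ) hli
    rwa [Fintype.card_subtype] at h
  · obtain ⟨g, hg0, hgsum, i₁, hi₁⟩ : ∃ g : I → ℝ, (∀ i, w i = 0 → g i = 0) ∧
        ∑ i, g i • v i = 0 ∧ ∃ i, 0 < g i := by
      have : ∃ g : I → ℝ, (∀ i, w i = 0 → g i = 0) ∧ ∑ i, g i • v i = 0 ∧ ∃ i, g i ≠ 0 := by
        unfold LinearIndepOn at hli
        rw [Fintype.linearIndependent_iff] at hli
        push Not at hli
        obtain ⟨g, hg, i, hi⟩ := hli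
        refine ⟨fun i => if h : w i ≠ 0 then g ⟨i, h⟩ else 0, fun i h => by simp [h], ?_,
          i, ?_⟩
        · rw [← hg, ← sum_filter_add_sum_filter_not univ (fun i => w i ≠ 0)]
          rw [sum_eq_zero (s := univ.filter fun i => ¬ w i ≠ 0), add_zero]
          · rw [sum_subtype (univ.filter fun i => w i ≠ 0) (p := fun i => i ∈ {i | w i ≠ 0})
              (by simp)]
            refine sum_congr rfl fun x _ => ?_
            have : w x.1 ≠ 0 := x.2
            simp [this]
          · intro x hx
            have : w x = 0 := by simpa using hx
            simp [this]
        · have : w i.1 ≠ 0 := i.2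
          simpa [this] using hi
      obtain ⟨g, h0, hs, i, hi⟩ := this
      rcases lt_or_gt_of_ne hi with h | h
      · refine ⟨fun i => - g i, fun i hi => by simp [h0 i hi], by simp [hs], i, by simpa using h⟩
      · exact ⟨g, h0, hs, i, h⟩
    obtain ⟨i₀, hi₀, hmin⟩ := exists_min_image (univ.filter fun i => 0 < g i)
      (fun i => w i / g i) ⟨i₁, by simpa using hi₁⟩
    have hgi₀ : 0 < g i₀ := by simpa using hi₀
    -- the largest step along `-g` that keeps all coefficients nonnegative
    set τ := w i₀ / g i₀ with hτ
    have hτ0 : 0 ≤ τ := div_nonneg (hw _) hgi₀.le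
    have hnn : ∀ i, 0 ≤ w i - τ * g i := by
      intro i
      rcases le_or_gt (g i) 0 with h | h
      · nlinarith [hw i, mul_nonneg hτ0 (neg_nonneg.2 h)]
      · have := hmin i (by simpa using h)
        rw [le_div_iff₀ h] at this
        linarith
    have hsub : ∀ i, w i = 0 → w i - τ * g i = 0 := fun i h => by simp [h, hg0 i h]
    have hcard : (univ.filter fun i => w i - τ * g i ≠ 0).card < n := by
      rw [← hn]
      refine card_lt_card ⟨?_, fun h => ?_⟩
      · intro i
        simp only [mem_filter, mem_univ, true_and]
        exact mt (hsub i)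
      · have h1 : i₀ ∈ univ.filter fun i => w i ≠ 0 := by
          simp only [mem_filter, mem_univ, true_and]
          intro h; exact hgi₀.ne' (hg0 _ h)
        have := h h1
        simp only [mem_filter, mem_univ, true_and] at this
        apply this
        rw [hτ, div_mul_cancel₀ _ hgi₀.ne', sub_self]
    obtain ⟨w', h1, h2, h3, h4⟩ := ih _ hcard _ hnn rfl
    refine ⟨w', h1, fun i h => h2 i (hsub i h), ?_, h4⟩
    rw [h3]
    simp only [sub_smul, sum_sub_distrib, mul_smul, ← smul_sum, hgsum, smul_zero, sub_zero]

/-! ### The positive part of a vector -/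

variable {N m : ℕ}

@[simp] theorem projPos_apply (v : Vec m) (j : Fin m) : projPos v j = max (v j) 0 := rfl

theorem normPlus_eq_norm_projPos (v : Vec m) : normPlus v = ‖projPos v‖ := by
  rw [EuclideanSpace.norm_eq]
  simp [normPlus]

theorem normPlus_nonneg (v : Vec m) : 0 ≤ normPlus v := Real.sqrt_nonneg _

theorem normPlus_sq (v : Vec m) : normPlus v ^ 2 = ∑ j, max (v j) 0 ^ 2 :=
  Real.sq_sqrt (sum_nonneg fun _ _ => sq_nonneg _)

theorem real_inner_eq_sum (v w : Vec m) : inner ℝ v w = ∑ j, v j * w j := by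
  rw [PiLp.inner_apply]
  exact sum_congr rfl fun j _ => by simp [mul_comm]

/-- Smoothness of `‖·‖₊²`. -/
theorem normPlus_add_sq_le (v d : Vec m) :
    normPlus (v + d) ^ 2 ≤ normPlus v ^ 2 + 2 * inner ℝ (projPos v) d + ‖d‖ ^ 2 := by
  rw [normPlus_sq, normPlus_sq, real_inner_eq_sum, EuclideanSpace.real_norm_sq_eq, mul_sum,
    ← sum_add_distrib, ← sum_add_distrib]
  refine sum_le_sum fun j _ => ?_
  simp only [PiLp.add_apply, projPos_apply]
  rcases le_total (v j + d j) 0 with h | h <;> rcases le_total (v j) 0 with h' | h' <;>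
    simp only [h, h', max_eq_left, max_eq_right] <;> nlinarith

/-- Convexity of `‖·‖₊²`, at a point where it vanishes. -/
theorem normPlus_sq_add_inner_nonpos (v w : Vec m) (hw : ∀ j, w j ≤ 0) :
    normPlus v ^ 2 + 2 * inner ℝ (projPos v) (w - v) ≤ - normPlus v ^ 2 := by
  rw [normPlus_sq, real_inner_eq_sum, mul_sum, ← sum_add_distrib, ← sum_neg_distrib]
  refine sum_le_sum fun j _ => ?_
  simp only [PiLp.sub_apply, projPos_apply]
  have := hw j
  rcases le_total (v j) 0 with h' | h' <;> simp only [h', max_eq_left, max_eq_right] <;> nlinarith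

theorem norm_projPos_sub_le (v u : Vec m) (hu : ∀ j, 0 ≤ u j) : ‖projPos v - u‖ ≤ ‖v - u‖ := by
  rw [EuclideanSpace.norm_eq, EuclideanSpace.norm_eq]
  refine Real.sqrt_le_sqrt (sum_le_sum fun j _ => ?_)
  simp only [PiLp.sub_apply, projPos_apply, Real.norm_eq_abs, sq_abs]
  have := hu j
  rcases le_total (v j) 0 with h' | h' <;> simp only [h', max_eq_left, max_eq_right] <;> nlinarith

theorem normPlus_add_le (v w : Vec m) : normPlus (v + w) ≤ normPlus v + ‖w‖ := by
  rw [normPlus_eq_norm_projPos, normPlus_eq_norm_projPos]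
  have : ‖projPos (v + w) - projPos v‖ ≤ ‖w‖ := by
    rw [EuclideanSpace.norm_eq, EuclideanSpace.norm_eq]
    refine Real.sqrt_le_sqrt (sum_le_sum fun j _ => ?_)
    refine pow_le_pow_left₀ (norm_nonneg _) ?_ 2
    simp only [PiLp.sub_apply, projPos_apply, PiLp.add_apply, Real.norm_eq_abs]
    simpa using abs_max_sub_max_le_abs (v j + w j) (v j) 0
  calc ‖projPos (v + w)‖ = ‖projPos v + (projPos (v + w) - projPos v)‖ := by congr 1; abel
    _ ≤ _ := (norm_add_le _ _).trans (by linarith)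

theorem normPlus_le_norm_of_le (v w : Vec m) (h : ∀ j, v j ≤ w j) : normPlus v ≤ ‖w‖ := by
  rw [EuclideanSpace.norm_eq]
  refine Real.sqrt_le_sqrt (sum_le_sum fun j _ => ?_)
  have := h j
  rw [Real.norm_eq_abs, sq_abs]
  rcases le_total (v j) 0 with h' | h' <;> simp only [h', max_eq_left, max_eq_right] <;> nlinarith

theorem normPlus_le_norm (v : Vec m) : normPlus v ≤ ‖v‖ :=
  normPlus_le_norm_of_le v v fun _ => le_rfl

/-! ### Bounds on the data and the dual function -/

theorem expect_fin_eq (f : Fin N → ℝ) : Finset.expect univ f = 1 / (N : ℝ) * ∑ i, f i := by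
  rw [Fintype.expect_eq_sum_div_card, Fintype.card_fin, one_div, div_eq_inv_mul]

namespace Problem

variable {P : Problem N m}

theorem Admissible.X_eq (hP : P.Admissible) (i : Fin N) : P.X i = dom (P.f i) :=
  (hP.convex_dom i).convexHull_eq

theorem abs_hval_le_H (hH : BddAbove P.absValues) {i : Fin N} {x : Vec (P.dim i)}
    (hx : x ∈ P.X i) : |P.hval i x| ≤ P.H :=
  le_csSup hH ⟨i, x, hx, rfl⟩

theorem Admissible.norm_sub_le_Gt (hP : P.Admissible) {i : Fin N} {x : Vec (P.dim i)}
    (hx : x ∈ P.X i) : ‖P.A i x - P.b‖ ≤ P.Gt := by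
  have hb : ∀ i, ∃ C : ℝ, ∀ x ∈ P.X i, ‖P.A i x - P.b‖ ≤ C := by
    intro i
    have hc : IsCompact (P.X i) := by rw [hP.X_eq]; exact hP.compact_dom i
    obtain ⟨C, hC⟩ := hc.bddAbove_image
      (f := fun x => ‖P.A i x - P.b‖) (by fun_prop)
    exact ⟨C, fun x hx => hC ⟨x, hx, rfl⟩⟩
  choose C hC using hb
  refine le_csSup ⟨∑ i, |C i|, ?_⟩ ⟨i, x, hx, rfl⟩
  rintro r ⟨i, x, hx, rfl⟩
  exact (hC i x hx).trans ((le_abs_self _).trans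
    (single_le_sum (f := fun i => |C i|) (fun _ _ => abs_nonneg _) (mem_univ i)))

theorem H_nonneg : 0 ≤ P.H := Real.sSup_nonneg (by rintro r ⟨i, x, -, rfl⟩; exact abs_nonneg _)

theorem Gt_nonneg : 0 ≤ P.Gt := Real.sSup_nonneg (by rintro r ⟨i, x, -, rfl⟩; exact norm_nonneg _)

variable {orc : (i : Fin N) → ℝ → Vec m → Vec (P.dim i)}

theorem IsOracle.mem_X (ho : P.IsOracle orc) (hP : P.Admissible) (i : Fin N) {γ : ℝ} (hγ : 0 ≤ γ)
    (lam : Vec m) : orc i γ lam ∈ P.X i := by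
  rw [hP.X_eq]; exact (ho i γ lam hγ).1

/-- The average over the blocks of the shifted Lagrangian. -/
theorem expect_lagrangian_eq [NeZero N] (u : Vec m) (c : Fin N → ℝ) (y : Fin N → Vec m) :
    Finset.expect univ (fun i => c i + inner ℝ u (y i - P.b)) =
      -inner ℝ u P.b + 1 / (N : ℝ) * ∑ i, (c i + inner ℝ u (y i)) := by
  rw [expect_fin_eq]
  have hN : (N : ℝ) ≠ 0 := NeZero.ne _
  simp only [inner_sub_right, sum_add_distrib, sum_sub_distrib, sum_const, card_univ,
    Fintype.card_fin, nsmul_eq_mul]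
  field_simp
  ring

theorem dual_le_expect [NeZero N] (hP : P.Admissible) (hH : BddAbove P.absValues) (u : Vec m)
    {x : (i : Fin N) → Vec (P.dim i)} (hx : ∀ i, x i ∈ P.X i) :
    P.dual u ≤ Finset.expect univ fun i => P.hval i (x i) + inner ℝ u (P.A i (x i) - P.b) := by
  rw [expect_lagrangian_eq, dual]
  gcongr with i
  refine csInf_le ⟨-P.H + (-(‖u‖ * P.Gt) + inner ℝ u P.b), ?_⟩ ⟨x i, hx i, rfl⟩
  rintro r ⟨y, hy, rfl⟩
  have h1 := abs_le.1 (abs_hval_le_H hH hy)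
  have h2 : -(‖u‖ * P.Gt) ≤ inner ℝ u (P.A i y - P.b) :=
    (neg_le_neg (mul_le_mul_of_nonneg_left (hP.norm_sub_le_Gt hy) (norm_nonneg _))).trans
      (abs_le.1 (abs_real_inner_le_norm u (P.A i y - P.b))).1
  rw [inner_sub_right] at h2
  simp only
  linarith [h1.1]

/-- The oracle answers at `λ` attain the infima in the definition of the dual function. -/
theorem dual_eq_expect [NeZero N] (hP : P.Admissible) (ho : P.IsOracle orc) (u : Vec m) :
    P.dual u = Finset.expect univ fun i =>
      P.hval i (orc i 1 u) + inner ℝ u (P.A i (orc i 1 u) - P.b) := by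
  rw [expect_lagrangian_eq, dual]
  congr 2
  refine sum_congr rfl fun i _ => ?_
  have hmin := (ho i 1 u zero_le_one).2.1
  simp only [one_mul] at hmin
  refine IsLeast.csInf_eq ⟨⟨_, ho.mem_X hP i zero_le_one u, rfl⟩, ?_⟩
  rintro r ⟨y, hy, rfl⟩
  exact hmin hy

/-- The averaged residual of the oracle answers at `v` is a supergradient of the dual function. -/
theorem dual_sub_dual_le [NeZero N] (hP : P.Admissible) (hH : BddAbove P.absValues)
    (ho : P.IsOracle orc) (u v : Vec m) :
    P.dual u - P.dual v ≤
      Finset.expect univ fun i => inner ℝ (P.A i (orc i 1 v) - P.b) (u - v) := by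
  have h1 := dual_le_expect hP hH u fun i => ho.mem_X hP i zero_le_one v
  rw [dual_eq_expect hP ho v]
  refine (sub_le_sub_right h1 _).trans (le_of_eq ?_)
  rw [← expect_sub_distrib]
  refine expect_congr rfl fun i _ => ?_
  rw [inner_sub_right _ u v, real_inner_comm u, real_inner_comm v]
  ring

theorem dual_sub_dual_le_norm [NeZero N] (hP : P.Admissible) (hH : BddAbove P.absValues)
    (ho : P.IsOracle orc) (u v : Vec m) : P.dual u - P.dual v ≤ P.Gt * ‖u - v‖ := by
  refine (dual_sub_dual_le hP hH ho u v).trans (expect_le univ_nonempty fun i _ => ?_)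
  exact (real_inner_le_norm _ _).trans (mul_le_mul_of_nonneg_right
    (hP.norm_sub_le_Gt (ho.mem_X hP i zero_le_one v)) (norm_nonneg _))

/-- Concavity of the dual function, for equal weights. -/
theorem expect_dual_le [NeZero N] (hP : P.Admissible) (hH : BddAbove P.absValues)
    (ho : P.IsOracle orc) {T : ℕ} (hT : 1 ≤ T) (v : ℕ → Vec m) :
    1 / (T : ℝ) * ∑ t ∈ range T, P.dual (v t) ≤
      P.dual ((1 / (T : ℝ)) • ∑ t ∈ range T, v t) := by
  set w := (1 / (T : ℝ)) • ∑ t ∈ range T, v t with hw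
  have hT0 : (0 : ℝ) < T := by exact_mod_cast hT
  have hsum : ∑ t ∈ range T, (v t - w) = 0 := by
    rw [sum_sub_distrib, sum_const, card_range, hw, ← Nat.cast_smul_eq_nsmul ℝ, smul_smul,
      mul_one_div_cancel hT0.ne', one_smul, sub_self]
  have : ∑ t ∈ range T, (P.dual (v t) - P.dual w) ≤ 0 := by
    calc _ ≤ ∑ t ∈ range T, Finset.expect univ fun i : Fin N =>
          inner ℝ (P.A i (orc i 1 w) - P.b) (v t - w) :=
        sum_le_sum fun t _ => dual_sub_dual_le hP hH ho _ _
      _ = 0 := by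
        rw [← expect_sum_comm]
        refine expect_eq_zero fun i _ => ?_
        rw [← inner_sum, hsum, inner_zero_right]
  rw [sum_sub_distrib, sum_const, card_range, nsmul_eq_mul] at this
  rw [one_div, inv_mul_le_iff₀ hT0]
  linarith

end Problem

/-! ### The dual iterates of the first stage -/

namespace Problem.Algo

variable {P : Problem N m} (a : P.Algo)

/-- Value of `hᵢ` at the oracle answer for the index `i` at step `t` of the first stage. -/
noncomputable def stepVal (ω : a.Sample) (t : ℕ) (i : Fin N) : ℝ := P.hval i (a.orc i 1 (a.lam ω t))

/-- Residual `Aᵢ x - b` at the oracle answer for the index `i` at step `t` of the first stage. -/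
noncomputable def stepRes (ω : a.Sample) (t : ℕ) (i : Fin N) : Vec m :=
  P.A i (a.orc i 1 (a.lam ω t)) - P.b

/-- Direction of step `t` of the first stage: the residual of the sampled block, and from step
`T - 1` on the averaged residual. -/
noncomputable def stepDir (ω : a.Sample) (t : ℕ) : Vec m :=
  if h : t < a.T - 1 then a.stepRes ω t (ω.1 ⟨t, h⟩)
  else (1 / (N : ℝ)) • ∑ i, a.stepRes ω t i

theorem lam_zero (ω : a.Sample) : a.lam ω 0 = a.lam0 := rfl

theorem lam_succ [NeZero N] (ω : a.Sample) (t : ℕ) :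
    a.lam ω (t + 1) = projPos (a.lam ω t + a.α t • a.stepDir ω t) := by
  by_cases h : t < a.T - 1
  · simp only [lam, stage1, stepDir, stepRes, h, dif_pos]
  · have hN : (N : ℝ) ≠ 0 := NeZero.ne _
    simp only [lam, stage1, stepDir, stepRes, h, dif_neg, not_false_eq_true, sum_sub_distrib,
      sum_const, card_univ, Fintype.card_fin, smul_sub, ← Nat.cast_smul_eq_nsmul ℝ, smul_smul]
    rw [one_div_mul_cancel hN, mul_one]

theorem lam_nonneg [NeZero N] (h0 : a.lam0 = 0) (ω : a.Sample) (t : ℕ) (j : Fin m) :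
    0 ≤ a.lam ω t j := by
  cases t with
  | zero => simp [lam_zero, h0]
  | succ t => rw [lam_succ]; exact le_max_right _ _

theorem lam_update_of_le [NeZero N] (s : Fin (a.T - 1)) (ω : a.Sample) (j : Fin N) {t : ℕ}
    (hts : t ≤ s) : a.lam (Function.update ω.1 s j, ω.2) t = a.lam ω t := by
  induction t with
  | zero => rfl
  | succ t ih =>
    have ht : t < a.T - 1 := by omega
    have e : Function.update ω.1 s j ⟨t, ht⟩ = ω.1 ⟨t, ht⟩ :=
      Function.update_of_ne (fun h => by rw [← h] at hts; simp at hts) _ _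
    have r : a.stepRes (Function.update ω.1 s j, ω.2) t = a.stepRes ω t := by
      funext i
      simp only [stepRes, ih (by omega)]
    rw [lam_succ, lam_succ, stepDir, stepDir, dif_pos ht, dif_pos ht, r, ih (by omega)]
    dsimp only
    rw [e]

theorem stage1_snd (ω₁ : Fin (a.T - 1) → Fin N) (ω₂ ω₂' : Fin a.K → Fin N) (t : ℕ) :
    a.stage1 (ω₁, ω₂) t = a.stage1 (ω₁, ω₂') t := by
  induction t with
  | zero => rfl
  | succ t ih => simp only [stage1, ih]

variable {a}

theorem abs_stepVal_le (hP : P.Admissible) (hH : BddAbove P.absValues) (ho : P.IsOracle a.orc)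
    (ω : a.Sample) (t : ℕ) (i : Fin N) : |a.stepVal ω t i| ≤ P.H :=
  abs_hval_le_H hH (ho.mem_X hP i zero_le_one _)

theorem norm_stepRes_le (hP : P.Admissible) (ho : P.IsOracle a.orc)
    (ω : a.Sample) (t : ℕ) (i : Fin N) : ‖a.stepRes ω t i‖ ≤ P.Gt :=
  hP.norm_sub_le_Gt (ho.mem_X hP i zero_le_one _)

theorem norm_avg_le [NeZero N] {E : Type*} [NormedAddCommGroup E] [NormedSpace ℝ E]
    {v : Fin N → E} {c : ℝ} (h : ∀ i, ‖v i‖ ≤ c) : ‖(1 / (N : ℝ)) • ∑ i, v i‖ ≤ c := by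
  have hN : (0 : ℝ) < N := by exact_mod_cast NeZero.pos N
  rw [norm_smul, Real.norm_of_nonneg (by positivity), one_div, inv_mul_le_iff₀ hN]
  refine (norm_sum_le _ _).trans ((sum_le_sum fun i _ => h i).trans ?_)
  simp

theorem norm_stepDir_le [NeZero N] (hP : P.Admissible) (ho : P.IsOracle a.orc)
    (ω : a.Sample) (t : ℕ) : ‖a.stepDir ω t‖ ≤ P.Gt := by
  unfold stepDir
  split
  · exact norm_stepRes_le hP ho _ _ _
  · exact norm_avg_le fun i => norm_stepRes_le hP ho _ _ _

/-- In expectation the step direction is a supergradient of the dual function. -/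
theorem expect_inner_stepDir_le [NeZero N] (hP : P.Admissible) (hH : BddAbove P.absValues)
    (ho : P.IsOracle a.orc) (t : ℕ) (u : Vec m) :
    (Finset.expect univ fun ω : a.Sample => inner ℝ (a.stepDir ω t) (a.lam ω t - u)) ≤
      - Finset.expect univ fun ω : a.Sample => P.dual u - P.dual (a.lam ω t) := by
  have key : ∀ ω : a.Sample, (Finset.expect univ fun i =>
      inner ℝ (a.stepRes ω t i) (a.lam ω t - u)) ≤ -(P.dual u - P.dual (a.lam ω t)) := by
    intro ω
    rw [le_neg, ← expect_neg_distrib]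
    refine (dual_sub_dual_le hP hH ho u (a.lam ω t)).trans (le_of_eq ?_)
    refine expect_congr rfl fun i _ => ?_
    rw [← inner_neg_right, neg_sub]; rfl
  rw [← expect_neg_distrib]
  refine le_trans (le_of_eq ?_) (expect_le_expect fun ω _ => key ω)
  by_cases h : t < a.T - 1
  · simp only [stepDir, h, dif_pos]
    refine expect_resample_fst ⟨t, h⟩
      (fun (ω : a.Sample) i => (inner ℝ (a.stepRes ω t i) (a.lam ω t - u) : ℝ)) fun ω j => ?_
    simp only [stepRes, a.lam_update_of_le ⟨t, h⟩ ω j le_rfl]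
  · simp only [stepDir, h, dif_neg, not_false_eq_true]
    refine expect_congr rfl fun ω _ => ?_
    rw [expect_fin_eq, inner_smul_left, sum_inner]
    simp

/-- The basic inequality of the stochastic supergradient method. -/
theorem expect_norm_sub_sq_add_le [NeZero N] (hP : P.Admissible) (hH : BddAbove P.absValues)
    (ho : P.IsOracle a.orc) (h0 : a.lam0 = 0) {α : ℝ} (hα : ∀ t, a.α t = α) (hα0 : 0 ≤ α)
    {u : Vec m} (hu : ∀ j, 0 ≤ u j) (t : ℕ) :
    (Finset.expect univ fun ω : a.Sample => ‖a.lam ω t - u‖ ^ 2) +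
      2 * α * ∑ s ∈ range t, Finset.expect univ (fun ω : a.Sample =>
        P.dual u - P.dual (a.lam ω s)) ≤ ‖u‖ ^ 2 + t * (α * P.Gt) ^ 2 := by
  induction t with
  | zero => simp [lam_zero, h0]
  | succ t ih =>
    have hstep : ∀ ω : a.Sample, ‖a.lam ω (t + 1) - u‖ ^ 2 ≤ ‖a.lam ω t - u‖ ^ 2 +
        2 * α * inner ℝ (a.stepDir ω t) (a.lam ω t - u) + (α * P.Gt) ^ 2 := by
      intro ω
      rw [lam_succ, hα]
      have h1 : ‖projPos (a.lam ω t + α • a.stepDir ω t) - u‖ ^ 2 ≤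
          ‖(a.lam ω t - u) + α • a.stepDir ω t‖ ^ 2 := by
        refine pow_le_pow_left₀ (norm_nonneg _) ?_ 2
        rw [← add_sub_right_comm]
        exact norm_projPos_sub_le _ u hu
      have h2 : ‖α • a.stepDir ω t‖ ^ 2 ≤ (α * P.Gt) ^ 2 := by
        refine pow_le_pow_left₀ (norm_nonneg _) ?_ 2
        rw [norm_smul, Real.norm_of_nonneg hα0]
        exact mul_le_mul_of_nonneg_left (norm_stepDir_le hP ho ω t) hα0
      rw [norm_add_sq_real, inner_smul_right, real_inner_comm] at h1
      linarith
    have h3 := expect_le_expect (s := univ) fun ω _ => hstep ω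
    rw [expect_add_distrib, expect_add_distrib, Fintype.expect_const, ← mul_expect] at h3
    have h4 := mul_le_mul_of_nonneg_left (expect_inner_stepDir_le hP hH ho t u)
      (by positivity : 0 ≤ 2 * α)
    rw [sum_range_succ, mul_add]
    push_cast
    linarith

/-! ### Rates of the first stage -/

/-- The bound on the second moments of the dual iterates of the first stage, as a function of
`‖λ*‖` and `Λ`. -/
def momentBound (L Λ : ℝ) : ℝ := 4 * L ^ 2 + 2 * Λ ^ 2

theorem momentBound_nonneg (L Λ : ℝ) : 0 ≤ momentBound L Λ := by unfold momentBound; positivity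

theorem stepsize_nonneg {Λ : ℝ} (hΛ : 0 < Λ) (T : ℕ) : 0 ≤ Λ / (P.Gt * √T) :=
  div_nonneg hΛ.le (mul_nonneg Gt_nonneg (Real.sqrt_nonneg _))

theorem nat_mul_stepsize_sq_le {Λ : ℝ} (hΛ : 0 < Λ) {T : ℕ} {t : ℕ} (ht : t ≤ T) (hT : 1 ≤ T) :
    t * (Λ / (P.Gt * √T) * P.Gt) ^ 2 ≤ Λ ^ 2 := by
  have hT0 : (0 : ℝ) < T := by exact_mod_cast hT
  have ht' : (t : ℝ) ≤ T := by exact_mod_cast ht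
  rcases Gt_nonneg (P := P).eq_or_lt with h | h
  · rw [← h]; simp; positivity
  · have e : Λ / (P.Gt * √T) * P.Gt = Λ / √T := by field_simp
    rw [e, div_pow, Real.sq_sqrt hT0.le]
    rw [mul_div_assoc', div_le_iff₀ hT0]
    nlinarith [sq_nonneg Λ]

theorem expect_norm_lam_sq_le [NeZero N] (hP : P.Admissible) (hH : BddAbove P.absValues)
    (ho : P.IsOracle a.orc) (h0 : a.lam0 = 0) {Λ : ℝ} (hΛ : 0 < Λ) (hT : 1 ≤ a.T)
    (hα : ∀ t, a.α t = Λ / (P.Gt * √a.T)) {lamStar : Vec m} (hs : P.IsDualSolution lamStar)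
    {t : ℕ} (ht : t ≤ a.T) :
    (Finset.expect univ fun ω : a.Sample => ‖a.lam ω t‖ ^ 2) ≤ momentBound ‖lamStar‖ Λ := by
  have h1 := expect_norm_sub_sq_add_le hP hH ho h0 hα (stepsize_nonneg hΛ _) hs.1 t
  have h2 := nat_mul_stepsize_sq_le (P := P) hΛ ht hT
  have h3 : 0 ≤ 2 * (Λ / (P.Gt * √a.T)) * ∑ s ∈ range t, Finset.expect univ (fun ω : a.Sample =>
        P.dual lamStar - P.dual (a.lam ω s)) :=
    mul_nonneg (mul_nonneg zero_le_two (stepsize_nonneg hΛ _)) (sum_nonneg fun s _ =>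
      expect_nonneg fun ω _ => sub_nonneg.2 (hs.2 _ (a.lam_nonneg h0 ω s)))
  have h4 : (Finset.expect univ fun ω : a.Sample => ‖a.lam ω t‖ ^ 2) ≤
      Finset.expect univ fun ω : a.Sample => 2 * ‖a.lam ω t - lamStar‖ ^ 2 + 2 * ‖lamStar‖ ^ 2 := by
    refine expect_le_expect fun ω _ => ?_
    have := norm_add_le (a.lam ω t - lamStar) lamStar
    rw [sub_add_cancel] at this
    nlinarith [sq_nonneg (‖a.lam ω t - lamStar‖ - ‖lamStar‖), norm_nonneg (a.lam ω t)]
  rw [expect_add_distrib, ← mul_expect, Fintype.expect_const] at h4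
  unfold momentBound
  linarith

theorem lamBar_nonneg [NeZero N] (h0 : a.lam0 = 0) (ω : a.Sample) (j : Fin m) :
    0 ≤ a.lamBar ω j := by
  have : a.lamBar ω j = (1 / (a.T : ℝ)) * ∑ t ∈ range a.T, a.lam ω t j := by
    simp [lamBar]
  rw [this]
  exact mul_nonneg (by positivity) (sum_nonneg fun t _ => a.lam_nonneg h0 ω t j)

/-- The dual suboptimality of the averaged iterate is of order `1/√T`. -/
theorem expect_dual_gap_le [NeZero N] (hP : P.Admissible) (hH : BddAbove P.absValues)
    (ho : P.IsOracle a.orc) (h0 : a.lam0 = 0) {Λ : ℝ} (hΛ : 0 < Λ) (hT : 1 ≤ a.T)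
    (hα : ∀ t, a.α t = Λ / (P.Gt * √a.T)) {lamStar : Vec m} (hs : P.IsDualSolution lamStar) :
    (Finset.expect univ fun ω : a.Sample => P.dual lamStar - P.dual (a.lamBar ω)) ≤
      P.Gt / 2 * (‖lamStar‖ ^ 2 / Λ + Λ) / √a.T := by
  have hT0 : (0 : ℝ) < a.T := by exact_mod_cast hT
  have hsT : 0 < √(a.T : ℝ) := Real.sqrt_pos.2 hT0
  rcases Gt_nonneg (P := P).eq_or_lt with hG | hG
  · rw [← hG, zero_div, zero_mul, zero_div]
    refine expect_le univ_nonempty fun ω _ => ?_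
    have := dual_sub_dual_le_norm hP hH ho lamStar (a.lamBar ω)
    rwa [← hG, zero_mul] at this
  · have hαpos : 0 < Λ / (P.Gt * √a.T) := by positivity
    have h1 := expect_norm_sub_sq_add_le hP hH ho h0 hα hαpos.le hs.1 a.T
    have h2 := nat_mul_stepsize_sq_le (P := P) hΛ le_rfl hT
    have h3 : 0 ≤ Finset.expect univ fun ω : a.Sample => ‖a.lam ω a.T - lamStar‖ ^ 2 :=
      expect_nonneg fun ω _ => sq_nonneg _
    have h4 : (Finset.expect univ fun ω : a.Sample => P.dual lamStar - P.dual (a.lamBar ω)) ≤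
        1 / (a.T : ℝ) * ∑ s ∈ range a.T, Finset.expect univ (fun ω : a.Sample =>
          P.dual lamStar - P.dual (a.lam ω s)) := by
      rw [← expect_sum_comm, mul_expect]
      refine expect_le_expect fun ω _ => ?_
      have := expect_dual_le hP hH ho hT (a.lam ω)
      rw [sum_sub_distrib, sum_const, card_range, nsmul_eq_mul, mul_sub, ← mul_assoc,
        one_div_mul_cancel hT0.ne', one_mul]
      exact sub_le_sub_left this _
    set S := ∑ s ∈ range a.T, Finset.expect univ (fun ω : a.Sample =>
          P.dual lamStar - P.dual (a.lam ω s))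
    have h5 : 2 * (Λ / (P.Gt * √a.T)) * S ≤ ‖lamStar‖ ^ 2 + Λ ^ 2 := by linarith
    refine h4.trans ?_
    have h6 : P.Gt / 2 * (‖lamStar‖ ^ 2 / Λ + Λ) / √a.T =
        1 / (a.T : ℝ) * ((‖lamStar‖ ^ 2 + Λ ^ 2) / (2 * (Λ / (P.Gt * √a.T)))) := by
      field_simp
      rw [Real.sq_sqrt hT0.le]
    rw [h6]
    gcongr
    rw [le_div_iff₀ (by positivity)]
    linarith

/-- The projected steps dominate the plain ones: `λ_t ≥ α ∑ g_s` coordinatewise. -/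
theorem smul_sum_stepDir_le_lam [NeZero N] (h0 : a.lam0 = 0) {α : ℝ} (hα : ∀ t, a.α t = α)
    (ω : a.Sample) (t : ℕ) (j : Fin m) :
    (α • ∑ s ∈ range t, a.stepDir ω s) j ≤ a.lam ω t j := by
  induction t with
  | zero => simp [lam_zero, h0]
  | succ t ih =>
    rw [lam_succ, hα, sum_range_succ, smul_add]
    simp only [PiLp.add_apply, projPos_apply]
    exact le_max_of_le_left (by linarith)

theorem normPlus_avg_stepDir_le [NeZero N] (hP : P.Admissible)
    (ho : P.IsOracle a.orc) (h0 : a.lam0 = 0) {Λ : ℝ} (hΛ : 0 < Λ) (hT : 1 ≤ a.T)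
    (hα : ∀ t, a.α t = Λ / (P.Gt * √a.T)) (ω : a.Sample) :
    normPlus ((1 / (a.T : ℝ)) • ∑ t ∈ range a.T, a.stepDir ω t) ≤
      P.Gt / Λ / √a.T * ‖a.lam ω a.T‖ := by
  have hT0 : (0 : ℝ) < a.T := by exact_mod_cast hT
  have hsT : 0 < √(a.T : ℝ) := Real.sqrt_pos.2 hT0
  rcases Gt_nonneg (P := P).eq_or_lt with hG | hG
  · have : ∀ t, a.stepDir ω t = 0 := fun t => by
      have := norm_stepDir_le hP ho ω t
      rw [← hG] at this
      exact norm_le_zero_iff.1 this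
    simp [this, ← hG, normPlus]
  · have hαpos : 0 < Λ / (P.Gt * √a.T) := by positivity
    refine (normPlus_le_norm_of_le _ ((P.Gt / Λ / √a.T) • a.lam ω a.T) fun j => ?_).trans
      (le_of_eq ?_)
    · have := smul_sum_stepDir_le_lam h0 hα ω a.T j
      simp only [PiLp.smul_apply, smul_eq_mul] at this ⊢
      have e : 1 / (a.T : ℝ) * (∑ t ∈ range a.T, a.stepDir ω t) j =
          P.Gt / Λ / √a.T * (Λ / (P.Gt * √a.T) * (∑ t ∈ range a.T, a.stepDir ω t) j) := by
        field_simp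
        rw [Real.sq_sqrt hT0.le, mul_comm]
      rw [e]
      exact mul_le_mul_of_nonneg_left this (by positivity)
    · rw [norm_smul, Real.norm_of_nonneg (by positivity)]

theorem neg_avg_inner_le [NeZero N] (hP : P.Admissible)
    (ho : P.IsOracle a.orc) (h0 : a.lam0 = 0) {Λ : ℝ} (hΛ : 0 < Λ) (hT : 1 ≤ a.T)
    (hα : ∀ t, a.α t = Λ / (P.Gt * √a.T)) (ω : a.Sample) :
    -(1 / (a.T : ℝ) * ∑ t ∈ range a.T, inner ℝ (a.lam ω t) (a.stepDir ω t)) ≤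
      Λ * P.Gt / 2 / √a.T := by
  have hT0 : (0 : ℝ) < a.T := by exact_mod_cast hT
  have hsT : 0 < √(a.T : ℝ) := Real.sqrt_pos.2 hT0
  rcases Gt_nonneg (P := P).eq_or_lt with hG | hG
  · have : ∀ t, a.stepDir ω t = 0 := fun t => by
      have := norm_stepDir_le hP ho ω t
      rw [← hG] at this
      exact norm_le_zero_iff.1 this
    simp [this, ← hG]
  · set α := Λ / (P.Gt * √a.T) with hαdef
    have hαpos : 0 < α := by positivity
    have key : ∀ t, ‖a.lam ω t‖ ^ 2 ≤
        2 * α * ∑ s ∈ range t, inner ℝ (a.lam ω s) (a.stepDir ω s) + t * (α * P.Gt) ^ 2 := by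
      intro t
      induction t with
      | zero => simp [lam_zero, h0]
      | succ t ih =>
        rw [lam_succ, hα, sum_range_succ]
        have h1 : ‖projPos (a.lam ω t + α • a.stepDir ω t)‖ ^ 2 ≤
            ‖a.lam ω t + α • a.stepDir ω t‖ ^ 2 := by
          refine pow_le_pow_left₀ (norm_nonneg _) ?_ 2
          rw [← normPlus_eq_norm_projPos]
          exact normPlus_le_norm _
        have h2 : ‖α • a.stepDir ω t‖ ^ 2 ≤ (α * P.Gt) ^ 2 := by
          refine pow_le_pow_left₀ (norm_nonneg _) ?_ 2
          rw [norm_smul, Real.norm_of_nonneg hαpos.le]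
          exact mul_le_mul_of_nonneg_left (norm_stepDir_le hP ho ω t) hαpos.le
        rw [norm_add_sq_real, inner_smul_right] at h1
        push_cast
        linarith
    have h1 := key a.T
    have h2 : 0 ≤ ‖a.lam ω a.T‖ ^ 2 := sq_nonneg _
    set S := ∑ s ∈ range a.T, inner ℝ (a.lam ω s) (a.stepDir ω s)
    have h3 : -S ≤ a.T * (α * P.Gt ^ 2) / 2 := by
      refine le_of_mul_le_mul_left ?_ (by positivity : 0 < 2 * α)
      nlinarith
    have h4 : Λ * P.Gt / 2 / √a.T = 1 / (a.T : ℝ) * (a.T * (α * P.Gt ^ 2) / 2) := by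
      rw [hαdef]; field_simp
    rw [h4, ← mul_neg]
    gcongr

/-! ### Sampled averages of the first stage -/

/-- From a family indexed by step and block, the term of step `t` that the first stage sees: that of
the sampled block, and from step `T - 1` on the average over the blocks. -/
noncomputable def sampled (a : P.Algo) {E : Type*} [AddCommGroup E] [Module ℝ E] (ω : a.Sample)
    (v : ℕ → Fin N → E) (t : ℕ) : E :=
  if h : t < a.T - 1 then v t (ω.1 ⟨t, h⟩) else (1 / (N : ℝ)) • ∑ i, v t i

theorem sum_range_sampled {E : Type*} [AddCommGroup E] [Module ℝ E] (hT : 1 ≤ a.T) (ω : a.Sample)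
    (v : ℕ → Fin N → E) :
    ∑ t ∈ range a.T, a.sampled ω v t =
      ∑ t : Fin (a.T - 1), v t (ω.1 t) + (1 / (N : ℝ)) • ∑ i, v (a.T - 1) i := by
  have e : range a.T = range (a.T - 1 + 1) := by congr 1; omega
  rw [e, sum_range_succ, sum_range]
  congr 1
  · exact sum_congr rfl fun t _ => by simp [sampled]
  · simp [sampled]

/-- The average of a family with which the second stage starts: within each block the average over
the steps at which the block was sampled and over the last step. -/
noncomputable def blockAvg (a : P.Algo) {E : Type*} [AddCommGroup E] [Module ℝ E] (ω : a.Sample)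
    (v : ℕ → Fin N → E) : E :=
  ∑ i, (1 / (N : ℝ)) • (1 / ((a.count ω i : ℝ) + 1)) • (v (a.T - 1) i + ∑ t with ω.1 t = i, v t i)

/-- Total deviation of the sampling frequencies from the uniform ones. -/
noncomputable def deviation (a : P.Algo) (ω : a.Sample) : ℝ :=
  ∑ i : Fin N, |(a.T : ℝ) / N - (a.count ω i + 1)| / a.T + N / a.T

/-- The start of the second stage averages each block separately, and the first stage averages over
all steps; the two differ by the deviation of the sampling frequencies. -/
theorem norm_blockAvg_sub_le [NeZero N] {E : Type*} [NormedAddCommGroup E] [NormedSpace ℝ E]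
    (hT : 1 ≤ a.T) (ω : a.Sample) {v : ℕ → Fin N → E} {c : ℝ} (hv : ∀ t i, ‖v t i‖ ≤ c) :
    ‖a.blockAvg ω v - (1 / (a.T : ℝ)) • ∑ t ∈ range a.T, a.sampled ω v t‖ ≤
      c * a.deviation ω := by
  have hT0 : (0 : ℝ) < a.T := by exact_mod_cast hT
  have hN : (0 : ℝ) < N := by exact_mod_cast NeZero.pos N
  have hN1 : (1 : ℝ) ≤ N := by exact_mod_cast NeZero.one_le (n := N)
  have hc : 0 ≤ c := (norm_nonneg _).trans (hv 0 0)
  have hfib : ∑ t : Fin (a.T - 1), v t (ω.1 t) = ∑ i, ∑ t with ω.1 t = i, v t i := by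
    rw [← sum_fiberwise univ ω.1]
    refine sum_congr rfl fun i _ => sum_congr rfl fun t ht => ?_
    rw [(mem_filter.1 ht).2]
  have hdec : a.blockAvg ω v - (1 / (a.T : ℝ)) • ∑ t ∈ range a.T, a.sampled ω v t =
      ∑ i, ((1 / (N : ℝ) * (1 / ((a.count ω i : ℝ) + 1)) - 1 / a.T) •
        (v (a.T - 1) i + ∑ t with ω.1 t = i, v t i) +
        (1 / (a.T : ℝ) - 1 / a.T * (1 / N)) • v (a.T - 1) i) := by
    rw [sum_range_sampled hT, hfib, smul_add, smul_sum, smul_smul, smul_sum, ← sum_add_distrib,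
      blockAvg, ← sum_sub_distrib]
    refine sum_congr rfl fun i _ => ?_
    module
  rw [hdec, deviation, mul_add, mul_sum]
  have hlast : c * (N / a.T) = ∑ i : Fin N, c * (1 / a.T) := by
    simp; ring
  rw [hlast, ← sum_add_distrib]
  refine (norm_sum_le _ _).trans (sum_le_sum fun i _ => (norm_add_le _ _).trans ?_)
  rw [norm_smul, norm_smul]
  have h1 : ‖v (a.T - 1) i + ∑ t with ω.1 t = i, v t i‖ ≤ (a.count ω i + 1) * c := by
    refine (norm_add_le _ _).trans ?_
    have : ‖∑ t with ω.1 t = i, v t i‖ ≤ a.count ω i * c := by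
      refine (norm_sum_le _ _).trans ((sum_le_sum fun t _ => hv t.1 i).trans (le_of_eq ?_))
      rw [sum_const, nsmul_eq_mul, count]
    linarith [hv (a.T - 1) i]
  have hI : (0 : ℝ) < a.count ω i + 1 := by positivity
  have h2 : ‖1 / (N : ℝ) * (1 / ((a.count ω i : ℝ) + 1)) - 1 / a.T‖ * (a.count ω i + 1) =
      |(a.T : ℝ) / N - (a.count ω i + 1)| / a.T := by
    rw [Real.norm_eq_abs, ← abs_of_pos hI, ← abs_mul, abs_of_pos hI, ← abs_of_pos hT0, ← abs_div,
      abs_of_pos hT0]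
    congr 1
    field_simp
  have h3 : ‖1 / (a.T : ℝ) - 1 / a.T * (1 / N)‖ ≤ 1 / a.T := by
    have h4 : 1 / (N : ℝ) ≤ 1 := by rw [div_le_one hN]; exact hN1
    have h5 : 0 ≤ 1 / (N : ℝ) := by positivity
    have h6 : 0 < 1 / (a.T : ℝ) := by positivity
    rw [Real.norm_eq_abs, abs_le]
    constructor <;> nlinarith
  refine add_le_add ?_ ?_
  · calc _ ≤ ‖1 / (N : ℝ) * (1 / ((a.count ω i : ℝ) + 1)) - 1 / a.T‖ * ((a.count ω i + 1) * c) :=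
          mul_le_mul_of_nonneg_left h1 (norm_nonneg _)
      _ = _ := by rw [← mul_assoc, h2, mul_comm]
  · rw [mul_comm]
    exact mul_le_mul (hv _ _) h3 (norm_nonneg _) hc

/-- The number of times that a block is sampled is binomial, hence of variance at most `T/N`. -/
theorem expect_abs_count_sub_le [NeZero N] (hT : 1 ≤ a.T) (i : Fin N) :
    (Finset.expect univ fun ω : a.Sample => |(a.T : ℝ) / N - (a.count ω i + 1)|) ≤
      √((a.T : ℝ) / N) + 1 := by
  classical
  have hN : (0 : ℝ) < N := by exact_mod_cast NeZero.pos N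
  have hN1 : (1 : ℝ) ≤ N := by exact_mod_cast NeZero.one_le (n := N)
  have hmean : (Finset.expect univ fun j : Fin N => if j = i then (1 : ℝ) else 0) = 1 / N := by
    rw [expect_fin_eq]; simp
  have hvar := expect_sq_sum_sub_expect_le (n := a.T - 1) (ι := Fin N) (κ := Fin a.K → Fin N)
    (fun _ _ j => if j = i then (1 : ℝ) else 0) (fun _ _ _ _ _ => rfl)
  have hsum : ∀ ω : a.Sample, ∑ t : Fin (a.T - 1), ((if ω.1 t = i then (1 : ℝ) else 0) - 1 / N) =
      a.count ω i - (a.T - 1) / N := by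
    intro ω
    rw [sum_sub_distrib, sum_boole, sum_const, card_univ, Fintype.card_fin, nsmul_eq_mul,
      Nat.cast_sub hT, count]
    push_cast
    ring
  simp only [hmean, hsum, ite_pow, one_pow, ne_eq, OfNat.ofNat_ne_zero, not_false_eq_true,
    zero_pow, Fintype.expect_const, sum_const, card_univ, Fintype.card_fin, nsmul_eq_mul] at hvar
  have hle : ((a.T - 1 : ℕ) : ℝ) * (1 / N) ≤ a.T / N := by
    rw [mul_one_div]
    gcongr
    omega
  have h1 : (Finset.expect univ fun ω : a.Sample => |(a.count ω i : ℝ) - (a.T - 1) / N|) ≤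
      √((a.T : ℝ) / N) := by
    refine expect_le_sqrt ?_
    simp only [sq_abs]
    exact hvar.trans hle
  calc _ ≤ Finset.expect univ fun ω : a.Sample => (|(a.count ω i : ℝ) - (a.T - 1) / N| + 1) := by
        refine expect_le_expect fun ω _ => ?_
        have e : (a.T : ℝ) / N - (a.count ω i + 1) =
          -((a.count ω i : ℝ) - (a.T - 1) / N) + (1 / N - 1) := by field_simp; ring
        rw [e]
        refine (abs_add_le _ _).trans ?_
        rw [abs_neg]
        have h4 : 1 / (N : ℝ) ≤ 1 := by rw [div_le_one hN]; exact hN1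
        have h5 : 0 ≤ 1 / (N : ℝ) := by positivity
        gcongr
        rw [abs_le]
        constructor <;> linarith
    _ ≤ _ := by
        rw [expect_add_distrib, Fintype.expect_const]
        linarith

theorem expect_deviation_le [NeZero N] (hT : 1 ≤ a.T) :
    Finset.expect univ a.deviation ≤ √((N : ℝ) / a.T) + 2 * (N / a.T) := by
  have hT0 : (0 : ℝ) < a.T := by exact_mod_cast hT
  have hN : (0 : ℝ) < N := by exact_mod_cast NeZero.pos N
  unfold deviation
  rw [expect_add_distrib, Fintype.expect_const, expect_sum_comm]
  have h1 : ∑ i : Fin N, (Finset.expect univ fun ω : a.Sample =>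
      |(a.T : ℝ) / N - (a.count ω i + 1)| / a.T) ≤ ∑ i : Fin N, (√((a.T : ℝ) / N) + 1) / a.T := by
    refine sum_le_sum fun i _ => ?_
    rw [← expect_div]
    exact div_le_div_of_nonneg_right (expect_abs_count_sub_le hT i) hT0.le
  have h2 : ∑ i : Fin N, (√((a.T : ℝ) / N) + 1) / a.T = √((N : ℝ) / a.T) + N / a.T := by
    rw [sum_const, card_univ, Fintype.card_fin, nsmul_eq_mul]
    have : (N : ℝ) * √((a.T : ℝ) / N) / a.T = √((N : ℝ) / a.T) := by
      rw [Real.sqrt_div hT0.le, Real.sqrt_div hN.le]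
      have ha := Real.sqrt_pos.2 hT0
      have hb := Real.sqrt_pos.2 hN
      field_simp
      rw [Real.sq_sqrt hN.le, Real.sq_sqrt hT0.le]
    rw [← this]
    ring
  linarith

/-- The sampled function values of the first stage exceed the dual value of the averaged iterate by
`O(1/√T)` in expectation. -/
theorem expect_sampled_val_sub_dual_le [NeZero N] (hP : P.Admissible) (hH : BddAbove P.absValues)
    (ho : P.IsOracle a.orc) (h0 : a.lam0 = 0) {Λ : ℝ} (hΛ : 0 < Λ) (hT : 1 ≤ a.T)
    (hα : ∀ t, a.α t = Λ / (P.Gt * √a.T)) {lamStar : Vec m} (hs : P.IsDualSolution lamStar) :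
    (Finset.expect univ fun ω : a.Sample => max
      (1 / (a.T : ℝ) * ∑ t ∈ range a.T, a.sampled ω (a.stepVal ω) t - P.dual (a.lamBar ω)) 0) ≤
      (√(2 * P.H ^ 2 + 2 * P.Gt ^ 2 * momentBound ‖lamStar‖ Λ) + Λ * P.Gt / 2) / √a.T := by
  have hT0 : (0 : ℝ) < a.T := by exact_mod_cast hT
  have hsT : 0 < √(a.T : ℝ) := Real.sqrt_pos.2 hT0
  set c := 2 * P.H ^ 2 + 2 * P.Gt ^ 2 * momentBound ‖lamStar‖ Λ with hc
  have hc0 : 0 ≤ c := by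
    have := momentBound_nonneg ‖lamStar‖ Λ
    positivity
  set X : Fin (a.T - 1) → a.Sample → Fin N → ℝ := fun t ω i =>
    a.stepVal ω t i + inner ℝ (a.lam ω t) (a.stepRes ω t i) with hX
  have hmean : ∀ (ω : a.Sample) (t : ℕ), P.dual (a.lam ω t) = Finset.expect univ fun i =>
      a.stepVal ω t i + inner ℝ (a.lam ω t) (a.stepRes ω t i) :=
    fun ω t => dual_eq_expect hP ho (a.lam ω t)
  set D : a.Sample → ℝ := fun ω => ∑ t, (X t ω (ω.1 t) - Finset.expect univ (X t ω)) with hD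
  have hD2 : (Finset.expect univ fun ω => D ω ^ 2) ≤ a.T * c := by
    refine (expect_sq_sum_sub_expect_le X ?_).trans ?_
    · intro t s hts ω j
      funext i
      simp only [hX, stepVal, stepRes, a.lam_update_of_le s ω j hts]
    · have : ∀ t : Fin (a.T - 1), (Finset.expect univ fun ω => Finset.expect univ fun j =>
          X t ω j ^ 2) ≤ c := by
        intro t
        calc _ ≤ Finset.expect univ fun ω : a.Sample =>
              (2 * P.H ^ 2 + 2 * P.Gt ^ 2 * ‖a.lam ω t‖ ^ 2) := by
              refine expect_le_expect fun ω _ => expect_le univ_nonempty fun j _ => ?_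
              have h1 := sq_le_sq' (abs_le.1 (abs_stepVal_le hP hH ho ω t j)).1
                (abs_le.1 (abs_stepVal_le hP hH ho ω t j)).2
              have h2 : |inner ℝ (a.lam ω t) (a.stepRes ω t j)| ≤ P.Gt * ‖a.lam ω t‖ := by
                refine (abs_real_inner_le_norm _ _).trans ?_
                rw [mul_comm]
                exact mul_le_mul_of_nonneg_right (norm_stepRes_le hP ho ω t j) (norm_nonneg _)
              have h3 := sq_le_sq' (abs_le.1 h2).1 (abs_le.1 h2).2
              simp only [hX]
              nlinarith [sq_nonneg (a.stepVal ω t j - inner ℝ (a.lam ω t) (a.stepRes ω t j))]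
          _ ≤ c := by
              rw [expect_add_distrib, Fintype.expect_const, ← mul_expect]
              have := expect_norm_lam_sq_le hP hH ho h0 hΛ hT hα hs (t := t) (by omega)
              rw [hc]
              gcongr
      refine (sum_le_sum fun t _ => this t).trans ?_
      rw [sum_const, card_univ, Fintype.card_fin, nsmul_eq_mul]
      gcongr
      omega
  have hDabs : (Finset.expect univ fun ω => |D ω|) ≤ √(a.T * c) := by
    refine expect_le_sqrt ?_
    simpa only [sq_abs] using hD2
  -- after subtraction of the mean, the last step contributes nothing
  have hdec : ∀ ω : a.Sample, ∑ t ∈ range a.T, a.sampled ω (a.stepVal ω) t +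
      ∑ t ∈ range a.T, inner ℝ (a.lam ω t) (a.stepDir ω t) -
      ∑ t ∈ range a.T, P.dual (a.lam ω t) = D ω := by
    intro ω
    have e : range a.T = range (a.T - 1 + 1) := by congr 1; omega
    rw [← sum_add_distrib, ← sum_sub_distrib, e, sum_range_succ, sum_range]
    have hlast : a.sampled ω (a.stepVal ω) (a.T - 1) +
        inner ℝ (a.lam ω (a.T - 1)) (a.stepDir ω (a.T - 1)) - P.dual (a.lam ω (a.T - 1)) = 0 := by
      rw [hmean, stepDir, sampled, dif_neg (lt_irrefl _), dif_neg (lt_irrefl _),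
        expect_add_distrib, expect_fin_eq, expect_fin_eq, inner_smul_right, inner_sum, smul_eq_mul]
      ring
    rw [hlast, add_zero]
    refine sum_congr rfl fun t _ => ?_
    rw [hmean, stepDir, sampled, dif_pos t.2, dif_pos t.2]
  have hpt : ∀ ω : a.Sample, max
      (1 / (a.T : ℝ) * ∑ t ∈ range a.T, a.sampled ω (a.stepVal ω) t - P.dual (a.lamBar ω)) 0 ≤
      1 / a.T * |D ω| + Λ * P.Gt / 2 / √a.T := by
    intro ω
    have h1 := expect_dual_le hP hH ho hT (a.lam ω)
    have h2 := neg_avg_inner_le hP ho h0 hΛ hT hα ω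
    have h3 : 1 / (a.T : ℝ) * D ω ≤ 1 / a.T * |D ω| :=
      mul_le_mul_of_nonneg_left (le_abs_self _) (by positivity)
    refine max_le ?_ ?_
    · rw [← hdec, mul_sub, mul_add, hdec] at h3
      change _ ≤ P.dual (a.lamBar ω) at h1
      linarith
    · have := Gt_nonneg (P := P)
      positivity
  refine (expect_le_expect fun ω _ => hpt ω).trans ?_
  rw [expect_add_distrib, Fintype.expect_const, ← mul_expect, add_div]
  gcongr
  calc _ ≤ 1 / (a.T : ℝ) * √(a.T * c) := by gcongr
    _ = _ := by
      rw [Real.sqrt_mul hT0.le]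
      field_simp
      rw [Real.sq_sqrt hT0.le]

/-- The residual of the sampled average of the first stage is infeasible by `O(1/√T)` only. -/
theorem expect_normPlus_avg_stepDir_le [NeZero N] (hP : P.Admissible) (hH : BddAbove P.absValues)
    (ho : P.IsOracle a.orc) (h0 : a.lam0 = 0) {Λ : ℝ} (hΛ : 0 < Λ) (hT : 1 ≤ a.T)
    (hα : ∀ t, a.α t = Λ / (P.Gt * √a.T)) {lamStar : Vec m} (hs : P.IsDualSolution lamStar) :
    (Finset.expect univ fun ω : a.Sample =>
      normPlus ((1 / (a.T : ℝ)) • ∑ t ∈ range a.T, a.stepDir ω t)) ≤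
      P.Gt / Λ * √(momentBound ‖lamStar‖ Λ) / √a.T := by
  refine (expect_le_expect fun ω _ =>
    normPlus_avg_stepDir_le hP ho h0 hΛ hT hα ω).trans ?_
  rw [← mul_expect, mul_div_right_comm]
  have := Gt_nonneg (P := P)
  gcongr
  exact expect_le_sqrt (expect_norm_lam_sq_le hP hH ho h0 hΛ hT hα hs le_rfl)

/-! ### States of the second stage as convex combinations -/

/-- Prescribed starting points, if any, lie in the domains, and `fᵢ` and `fᵢ**` agree there. -/
def ValidStart (a : P.Algo) : Prop :=
  ∀ x0, a.start = .points x0 → ∀ i, x0 i ∈ dom (P.f i) ∧ P.f i (x0 i) = biconj (P.f i) (x0 i)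

theorem gradβ_nonneg (ω : a.Sample) (s : Stage2State N m) : 0 ≤ a.gradβ ω s := le_max_right _ _

theorem pt_spec (ho : P.IsOracle a.orc) (hst : a.ValidStart) (ω : a.Sample) (i : Fin N)
    (l : a.Label) :
    a.pt ω i l ∈ dom (P.f i) ∧ P.f i (a.pt ω i l) = biconj (P.f i) (a.pt ω i l) := by
  rcases l with l | k
  · simp only [pt, startPt]
    split
    · split
      · exact ⟨(ho _ _ _ zero_le_one).1, (ho _ _ _ zero_le_one).2.2⟩
      · exact ⟨(ho _ _ _ zero_le_one).1, (ho _ _ _ zero_le_one).2.2⟩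
    · rename_i x0 h
      exact hst x0 h i
  · exact ⟨(ho _ _ _ (gradβ_nonneg _ _)).1, (ho _ _ _ (gradβ_nonneg _ _)).2.2⟩

theorem fval_pt (ho : P.IsOracle a.orc) (hst : a.ValidStart) (ω : a.Sample) (i : Fin N)
    (l : a.Label) : P.fval i (a.pt ω i l) = P.hval i (a.pt ω i l) := by
  rw [fval, hval, (pt_spec ho hst ω i l).2]

theorem pt_mem_X (hP : P.Admissible) (ho : P.IsOracle a.orc) (hst : a.ValidStart) (ω : a.Sample)
    (i : Fin N) (l : a.Label) : a.pt ω i l ∈ P.X i := by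
  rw [hP.X_eq]; exact (pt_spec ho hst ω i l).1

/-- The pair `(β, z)` is a convex combination of the pairs `(hᵢ(x)/N, Aᵢ x/N)` over the points that
are available for the index `i`. -/
def IsBlockCombination (a : P.Algo) (ω : a.Sample) (i : Fin N) (β : ℝ) (z : Vec m) : Prop :=
  ∃ w : a.Label → ℝ, (∀ l, 0 ≤ w l) ∧ (∀ l, l ∉ a.Q ω i → w l = 0) ∧ ∑ l, w l = 1 ∧
    β = ∑ l, w l * (1 / (N : ℝ) * P.hval i (a.pt ω i l)) ∧
    z = ∑ l, w l • (1 / (N : ℝ)) • P.A i (a.pt ω i l)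

theorem isBlockCombination_zero (ω : a.Sample) (i : Fin N) :
    a.IsBlockCombination ω i (a.β0 ω i) (a.z0 ω i) := by
  classical
  cases hs : a.start with
  | averages =>
    have hI : ((a.count ω i : ℝ) + 1) ≠ 0 := by positivity
    refine ⟨fun l => match l with
      | .inl none => 1 / ((a.count ω i : ℝ) + 1)
      | .inl (some t) => if ω.1 t = i then 1 / ((a.count ω i : ℝ) + 1) else 0
      | .inr _ => 0, ?_, ?_, ?_, ?_, ?_⟩
    · rintro ((_ | t) | k)
      · positivity
      · dsimp only; split <;> positivity
      · exact le_rfl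
    · rintro ((_ | t) | k) hl
      · exact absurd trivial hl
      · dsimp only
        rw [if_neg]
        exact fun h => hl ⟨hs, h⟩
      · rfl
    · simp only [Fintype.sum_sum_type, Fintype.sum_option, sum_const_zero, add_zero]
      rw [← sum_filter, sum_const, nsmul_eq_mul, count] at *
      field_simp
      ring
    · simp only [Fintype.sum_sum_type, Fintype.sum_option, β0, hs, pt, startPt, zero_mul,
        sum_const_zero, add_zero, ite_mul, ← sum_filter, ← mul_sum, ← mul_add]
    · simp only [Fintype.sum_sum_type, Fintype.sum_option, z0, hs, pt, startPt, zero_smul,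
        sum_const_zero, add_zero, ite_smul, ← sum_filter, ← smul_sum, ← smul_add, map_smul,
        map_add, map_sum]
      rw [smul_comm]
  | points x0 =>
    refine ⟨Pi.single (.inl none) 1, fun l => ?_, fun l hl => ?_, by simp, ?_, ?_⟩
    · rw [Pi.single_apply]; split <;> norm_num
    · rw [Pi.single_apply, if_neg]
      rintro rfl
      exact hl trivial
    · rw [sum_eq_single (.inl none)]
      · simp [β0, hs, pt, startPt]
      · intro l _ hl; simp [hl]
      · simp
    · rw [sum_eq_single (.inl none)]
      · simp [z0, hs, pt, startPt]
      · intro l _ hl; simp [hl]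
      · simp

/-- One block-coordinate step with index `i` from the state `s`. -/
noncomputable def blockStep (a : P.Algo) (ω : a.Sample) (k : ℕ) (s : Stage2State N m) (i : Fin N) :
    Stage2State N m :=
  ⟨Function.update s.β i ((1 - 2 * N / (k + 2 * N)) * s.β i +
      2 * N / (k + 2 * N) * (1 / (N : ℝ) * P.hval i (a.orc i (a.gradβ ω s) (gradz (P := P) s)))),
    Function.update s.z i ((1 - 2 * N / (k + 2 * N) : ℝ) • s.z i +
      (2 * N / (k + 2 * N) : ℝ) • (1 / (N : ℝ)) •
        P.A i (a.orc i (a.gradβ ω s) (gradz (P := P) s))),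
    s.calls + 1⟩

theorem stage2_succ (ω : a.Sample) {k : ℕ} (h : k < a.K) :
    a.stage2 ω (k + 1) = a.blockStep ω k (a.stage2 ω k) (ω.2 ⟨k, h⟩) := by
  rw [stage2]
  simp only [h, dif_pos]
  rfl

theorem isBlockCombination_stage2 [NeZero N] (ω : a.Sample) {k : ℕ} (hk : k ≤ a.K) (i : Fin N) :
    a.IsBlockCombination ω i ((a.stage2 ω k).β i) ((a.stage2 ω k).z i) := by
  classical
  induction k with
  | zero => exact isBlockCombination_zero ω i
  | succ k ih =>
    obtain ⟨w, h1, h2, h3, h4, h5⟩ := ih (by omega)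
    have hk' : k < a.K := by omega
    rw [stage2_succ ω hk']
    by_cases hi : i = ω.2 ⟨k, hk'⟩
    · have hN : (0 : ℝ) < N := by exact_mod_cast NeZero.pos N
      have hden : (0 : ℝ) < k + 2 * N := by positivity
      set r : ℝ := 2 * N / (k + 2 * N) with hr
      have hr0 : 0 ≤ r := by positivity
      have hr1 : r ≤ 1 := by
        rw [hr, div_le_one hden]
        have : (0 : ℝ) ≤ k := by positivity
        linarith
      refine ⟨fun l => (1 - r) * w l + r * Pi.single (M := fun _ => ℝ) (Sum.inr ⟨k, hk'⟩) 1 l,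
        fun l => ?_, fun l hl => ?_, ?_, ?_, ?_⟩
      · refine add_nonneg (mul_nonneg (by linarith) (h1 l)) (mul_nonneg hr0 ?_)
        rw [Pi.single_apply]; split <;> norm_num
      · dsimp only
        rw [h2 l hl, Pi.single_apply, if_neg]
        · simp
        · rintro rfl
          exact hl hi.symm
      · rw [sum_add_distrib, ← mul_sum, ← mul_sum, h3]
        simp
      · subst hi
        simp only [blockStep, Function.update_self, add_mul, sum_add_distrib, mul_assoc,
          ← mul_sum, ← h4]
        rw [sum_eq_single (.inr ⟨k, hk'⟩)]
        · simp [pt, ← hr]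
        · intro l _ hl; simp [hl]
        · simp
      · subst hi
        simp only [blockStep, Function.update_self, add_smul, sum_add_distrib, mul_smul,
          ← smul_sum, ← h5]
        rw [sum_eq_single (.inr ⟨k, hk'⟩)]
        · simp [pt, ← hr]
        · intro l _ hl; simp [hl]
        · simp
    · refine ⟨w, h1, h2, h3, ?_, ?_⟩
      · simp only [blockStep, Function.update_of_ne hi, h4]
      · simp only [blockStep, Function.update_of_ne hi, h5]

theorem IsBlockCombination.abs_sub_le [NeZero N] (hP : P.Admissible) (hH : BddAbove P.absValues)
    (ho : P.IsOracle a.orc) (hst : a.ValidStart) {ω : a.Sample} {i : Fin N} {β : ℝ} {z : Vec m}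
    (h : a.IsBlockCombination ω i β z) {x : Vec (P.dim i)} (hx : x ∈ P.X i) :
    |1 / (N : ℝ) * P.hval i x - β| ≤ 1 / (N : ℝ) * (2 * P.H) := by
  obtain ⟨w, h1, -, h3, rfl, -⟩ := h
  have hN : (0 : ℝ) < N := by exact_mod_cast NeZero.pos N
  have e : 1 / (N : ℝ) * P.hval i x - ∑ l, w l * (1 / (N : ℝ) * P.hval i (a.pt ω i l)) =
      ∑ l, w l * (1 / (N : ℝ) * (P.hval i x - P.hval i (a.pt ω i l))) := by
    simp only [mul_sub, sum_sub_distrib, ← sum_mul, h3, one_mul]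
  rw [e]
  refine (abs_sum_le_sum_abs _ _).trans ?_
  calc _ ≤ ∑ l, w l * (1 / (N : ℝ) * (2 * P.H)) := by
        refine sum_le_sum fun l _ => ?_
        rw [abs_mul, abs_of_nonneg (h1 l), abs_mul, abs_of_pos (by positivity : 0 < 1 / (N : ℝ))]
        have h4 := abs_hval_le_H hH hx
        have h5 := abs_hval_le_H hH (pt_mem_X hP ho hst ω i l)
        have h6 := abs_sub (P.hval i x) (P.hval i (a.pt ω i l))
        have := h1 l
        gcongr
        linarith
    _ = _ := by rw [← sum_mul, h3, one_mul]

theorem IsBlockCombination.norm_smul_sub_le [NeZero N] (hP : P.Admissible)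
    (ho : P.IsOracle a.orc) (hst : a.ValidStart) {ω : a.Sample} {i : Fin N} {β : ℝ} {z : Vec m}
    (h : a.IsBlockCombination ω i β z) {x : Vec (P.dim i)} (hx : x ∈ P.X i) :
    ‖(1 / (N : ℝ)) • P.A i x - z‖ ≤ 1 / (N : ℝ) * (2 * P.Gt) := by
  obtain ⟨w, h1, -, h3, -, rfl⟩ := h
  have hN : (0 : ℝ) < N := by exact_mod_cast NeZero.pos N
  have e : (1 / (N : ℝ)) • P.A i x - ∑ l, w l • (1 / (N : ℝ)) • P.A i (a.pt ω i l) =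
      ∑ l, w l • (1 / (N : ℝ)) • ((P.A i x - P.b) - (P.A i (a.pt ω i l) - P.b)) := by
    simp only [sub_sub_sub_cancel_right, smul_sub, sum_sub_distrib, ← sum_smul, h3, one_smul]
  rw [e]
  refine (norm_sum_le _ _).trans ?_
  calc _ ≤ ∑ l, w l * (1 / (N : ℝ) * (2 * P.Gt)) := by
        refine sum_le_sum fun l _ => ?_
        rw [norm_smul, Real.norm_of_nonneg (h1 l), norm_smul,
          Real.norm_of_nonneg (by positivity : 0 ≤ 1 / (N : ℝ))]
        have h4 := hP.norm_sub_le_Gt hx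
        have h5 := hP.norm_sub_le_Gt (pt_mem_X hP ho hst ω i l)
        have h6 := norm_sub_le (P.A i x - P.b) (P.A i (a.pt ω i l) - P.b)
        have := h1 l
        gcongr
        linarith
    _ = _ := by rw [← sum_mul, h3, one_mul]

/-! ### Convergence of the second stage -/

/-- Twice the objective `F` of the second stage. -/
noncomputable def objective (a : P.Algo) (ω : a.Sample) (s : Stage2State N m) : ℝ :=
  a.gradβ ω s ^ 2 + normPlus (∑ i, s.z i - P.b) ^ 2

theorem objective_nonneg (ω : a.Sample) (s : Stage2State N m) : 0 ≤ a.objective ω s := by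
  unfold objective; positivity

theorem sum_update_eq {E : Type*} [AddCommGroup E] (f : Fin N → E) (i : Fin N) (v : E) :
    ∑ j, Function.update f i v j = ∑ j, f j + (v - f i) := by
  have : ∀ j, Function.update f i v j = f j + if j = i then v - f i else 0 := by
    intro j
    by_cases h : j = i
    · subst h; simp
    · simp [h]
  simp only [this, sum_add_distrib, sum_ite_eq', mem_univ, if_true]

theorem max_add_sq_le (u d : ℝ) : max (u + d) 0 ^ 2 ≤ max u 0 ^ 2 + 2 * (max u 0 * d) + d ^ 2 := by
  rcases le_total (u + d) 0 with h | h <;> rcases le_total u 0 with h' | h' <;>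
    simp only [h, h', max_eq_left, max_eq_right] <;> nlinarith

/-- Descent of the objective in one block step, by the smoothness of `F`. -/
theorem objective_blockStep_le [NeZero N] (hP : P.Admissible) (hH : BddAbove P.absValues)
    (ho : P.IsOracle a.orc) (hst : a.ValidStart) (ω : a.Sample) {k : ℕ} (hk : k ≤ a.K)
    (i : Fin N) {s : Stage2State N m} (hs : s = a.stage2 ω k) {x : Vec (P.dim i)}
    (hx : x = a.orc i (a.gradβ ω s) (gradz (P := P) s)) :
    a.objective ω (a.blockStep ω k s i) ≤ a.objective ω s + 2 * (2 * N / (k + 2 * N)) *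
      (a.gradβ ω s * (1 / (N : ℝ) * P.hval i x - s.β i) +
        inner ℝ (gradz (P := P) s) ((1 / (N : ℝ)) • P.A i x - s.z i)) +
      16 * (P.H ^ 2 + P.Gt ^ 2) / (k + 2 * N) ^ 2 := by
  have hN : (0 : ℝ) < N := by exact_mod_cast NeZero.pos N
  have hden : (0 : ℝ) < k + 2 * N := by positivity
  have hX : x ∈ P.X i := hx ▸ ho.mem_X hP i (gradβ_nonneg ω s) _
  have hcomb := isBlockCombination_stage2 ω hk i
  rw [← hs] at hcomb
  have hb := hcomb.abs_sub_le hP hH ho hst hX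
  have hz := hcomb.norm_smul_sub_le hP ho hst hX
  set r : ℝ := 2 * N / (k + 2 * N) with hr
  set db := 1 / (N : ℝ) * P.hval i x - s.β i with hdb
  set dz := (1 / (N : ℝ)) • P.A i x - s.z i with hdz
  have e1 : ∑ j, (a.blockStep ω k s i).β j = ∑ j, s.β j + r * db := by
    simp only [blockStep, sum_update_eq, ← hr, ← hx, hdb]
    ring
  have e2 : ∑ j, (a.blockStep ω k s i).z j = ∑ j, s.z j + r • dz := by
    simp only [blockStep, sum_update_eq, ← hr, ← hx, hdz]
    module
  have h1 := max_add_sq_le (∑ j, s.β j - P.dual (a.lamBar ω)) (r * db)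
  have h2 := normPlus_add_sq_le (∑ j, s.z j - P.b) (r • dz)
  rw [norm_smul, inner_smul_right, mul_pow, Real.norm_eq_abs, sq_abs] at h2
  have hb2 : db ^ 2 ≤ (1 / (N : ℝ) * (2 * P.H)) ^ 2 := by
    rw [← sq_abs]; exact pow_le_pow_left₀ (abs_nonneg _) hb 2
  have hz2 : ‖dz‖ ^ 2 ≤ (1 / (N : ℝ) * (2 * P.Gt)) ^ 2 := pow_le_pow_left₀ (norm_nonneg _) hz 2
  have e3 : r ^ 2 * ((1 / (N : ℝ) * (2 * P.H)) ^ 2 + (1 / (N : ℝ) * (2 * P.Gt)) ^ 2) =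
      16 * (P.H ^ 2 + P.Gt ^ 2) / (k + 2 * N) ^ 2 := by
    rw [hr]; field_simp; ring
  have h3 : r ^ 2 * (db ^ 2 + ‖dz‖ ^ 2) ≤
      r ^ 2 * ((1 / (N : ℝ) * (2 * P.H)) ^ 2 + (1 / (N : ℝ) * (2 * P.Gt)) ^ 2) := by gcongr
  rw [e3] at h3
  rw [objective, objective, gradβ, gradβ, gradz, e1, e2, add_sub_right_comm, add_sub_right_comm]
  linarith

/-- The block steps decrease the objective on average towards its value at any feasible point of
the bidual problem, since the oracle minimizes the linearization of `F` in each block. -/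
theorem expect_objective_blockStep_le [NeZero N] (hP : P.Admissible) (hH : BddAbove P.absValues)
    (ho : P.IsOracle a.orc) (hst : a.ValidStart) (ω : a.Sample) {k : ℕ} (hk : k ≤ a.K)
    {y : (i : Fin N) → Vec (P.dim i)} (hy : ∀ i, y i ∈ P.X i)
    (hfeas : ∀ j, ((1 / (N : ℝ)) • ∑ i, P.A i (y i)) j ≤ P.b j) :
    (Finset.expect univ fun i => a.objective ω (a.blockStep ω k (a.stage2 ω k) i)) ≤
      (1 - 2 / (k + 2 * N)) * a.objective ω (a.stage2 ω k) +
      2 / (k + 2 * N) * max (1 / (N : ℝ) * ∑ i, P.hval i (y i) - P.dual (a.lamBar ω)) 0 ^ 2 +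
      16 * (P.H ^ 2 + P.Gt ^ 2) / (k + 2 * N) ^ 2 := by
  have hN : (0 : ℝ) < N := by exact_mod_cast NeZero.pos N
  have hden : (0 : ℝ) < k + 2 * N := by positivity
  set s := a.stage2 ω k with hs
  set γ := a.gradβ ω s with hγ
  set g := gradz (P := P) s with hg
  have h1 := expect_le_expect (s := univ) fun i _ =>
    objective_blockStep_le hP hH ho hst ω hk i hs rfl
  rw [expect_add_distrib, expect_add_distrib, Fintype.expect_const, Fintype.expect_const,
    ← mul_expect, expect_fin_eq (fun i => γ * _ + _)] at h1
  have hblock : ∀ i, γ * (1 / (N : ℝ) * P.hval i (a.orc i γ g) - s.β i) +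
      inner ℝ g ((1 / (N : ℝ)) • P.A i (a.orc i γ g) - s.z i) ≤
      γ * (1 / (N : ℝ) * P.hval i (y i) - s.β i) +
      inner ℝ g ((1 / (N : ℝ)) • P.A i (y i) - s.z i) := by
    intro i
    have := (ho i γ g (gradβ_nonneg ω s)).2.1 (hy i)
    simp only [Set.mem_ofPred_eq] at this
    have h2 := mul_le_mul_of_nonneg_left this (by positivity : 0 ≤ 1 / (N : ℝ))
    simp only [inner_sub_right, inner_smul_right]
    linarith
  have hsum : ∑ i, (γ * (1 / (N : ℝ) * P.hval i (y i) - s.β i) +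
      inner ℝ g ((1 / (N : ℝ)) • P.A i (y i) - s.z i)) =
      γ * (1 / (N : ℝ) * ∑ i, P.hval i (y i) - ∑ i, s.β i) +
      inner ℝ g (((1 / (N : ℝ)) • ∑ i, P.A i (y i) - P.b) - (∑ i, s.z i - P.b)) := by
    rw [sum_add_distrib, ← mul_sum, sum_sub_distrib, ← mul_sum, ← inner_sum, sum_sub_distrib,
      ← smul_sum, sub_sub_sub_cancel_right]
  have h3 := normPlus_sq_add_inner_nonpos (∑ i, s.z i - P.b)
    ((1 / (N : ℝ)) • ∑ i, P.A i (y i) - P.b)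
    (fun j => by have := hfeas j; simp only [PiLp.sub_apply]; linarith)
  have h4 : 2 * (γ * (1 / (N : ℝ) * ∑ i, P.hval i (y i) - ∑ i, s.β i)) ≤
      max (1 / (N : ℝ) * ∑ i, P.hval i (y i) - P.dual (a.lamBar ω)) 0 ^ 2 - γ ^ 2 := by
    rw [hγ, gradβ]
    set u := ∑ i, s.β i - P.dual (a.lamBar ω)
    set v := 1 / (N : ℝ) * ∑ i, P.hval i (y i) - P.dual (a.lamBar ω)
    have e : 1 / (N : ℝ) * ∑ i, P.hval i (y i) - ∑ i, s.β i = v - u := by ring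
    rw [e]
    rcases le_total u 0 with h | h <;> rcases le_total v 0 with h' | h' <;>
      simp only [h, h', max_eq_left, max_eq_right] <;> nlinarith [sq_nonneg (u - v)]
  have h5 := sum_le_sum fun i (_ : i ∈ univ) => hblock i
  rw [hsum] at h5
  have h6 : 2 * (2 * (N : ℝ) / (k + 2 * N)) * (1 / N * ∑ i, (γ * (1 / (N : ℝ) *
      P.hval i (a.orc i γ g) - s.β i) + inner ℝ g ((1 / (N : ℝ)) • P.A i (a.orc i γ g) - s.z i))) ≤
      2 / (k + 2 * N) * (max (1 / (N : ℝ) * ∑ i, P.hval i (y i) - P.dual (a.lamBar ω)) 0 ^ 2 -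
        a.objective ω s) := by
    have e : ∀ q : ℝ, 2 * (2 * (N : ℝ) / (k + 2 * N)) * (1 / N * q) =
        2 / (k + 2 * N) * (2 * q) := fun q => by field_simp
    rw [e]
    refine mul_le_mul_of_nonneg_left ?_ (by positivity)
    have h7 : a.objective ω s = γ ^ 2 + normPlus (∑ i, s.z i - P.b) ^ 2 := rfl
    rw [h7]
    change _ + 2 * inner ℝ g _ ≤ _ at h3
    linarith [sq_nonneg (normPlus (∑ i, s.z i - P.b))]
  linarith

theorem lam_snd (ω₁ : Fin (a.T - 1) → Fin N) (ω₂ ω₂' : Fin a.K → Fin N) :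
    a.lam (ω₁, ω₂) = a.lam (ω₁, ω₂') := by
  funext t
  rw [lam, lam, a.stage1_snd ω₁ ω₂ ω₂']

theorem lamBar_snd (ω₁ : Fin (a.T - 1) → Fin N) (ω₂ ω₂' : Fin a.K → Fin N) :
    a.lamBar (ω₁, ω₂) = a.lamBar (ω₁, ω₂') := by
  rw [lamBar, lamBar, lam_snd ω₁ ω₂ ω₂']

theorem stage2_zero_snd (ω₁ : Fin (a.T - 1) → Fin N) (ω₂ ω₂' : Fin a.K → Fin N) :
    a.stage2 (ω₁, ω₂) 0 = a.stage2 (ω₁, ω₂') 0 := by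
  have h1 : a.β0 (ω₁, ω₂) = a.β0 (ω₁, ω₂') := by
    funext i
    simp only [β0, lam_snd ω₁ ω₂ ω₂', count]
  have h2 : a.z0 (ω₁, ω₂) = a.z0 (ω₁, ω₂') := by
    funext i
    simp only [z0, lam_snd ω₁ ω₂ ω₂', count]
  rw [stage2, stage2, h1, h2]

theorem gradβ_snd (ω₁ : Fin (a.T - 1) → Fin N) (ω₂ ω₂' : Fin a.K → Fin N) :
    a.gradβ (ω₁, ω₂) = a.gradβ (ω₁, ω₂') := by
  funext s
  rw [gradβ, gradβ, lamBar_snd ω₁ ω₂ ω₂']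

theorem objective_snd (ω₁ : Fin (a.T - 1) → Fin N) (ω₂ ω₂' : Fin a.K → Fin N) :
    a.objective (ω₁, ω₂) = a.objective (ω₁, ω₂') := by
  funext s
  rw [objective, objective, gradβ_snd ω₁ ω₂ ω₂']

theorem blockStep_snd (ω₁ : Fin (a.T - 1) → Fin N) (ω₂ ω₂' : Fin a.K → Fin N) :
    a.blockStep (ω₁, ω₂) = a.blockStep (ω₁, ω₂') := by
  funext k s i
  rw [blockStep, blockStep, gradβ_snd ω₁ ω₂ ω₂']

theorem stage2_update_of_le (ω₁ : Fin (a.T - 1) → Fin N) (ω₂ : Fin a.K → Fin N) (t : Fin a.K)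
    (j : Fin N) {k : ℕ} (hk : k ≤ t) :
    a.stage2 (ω₁, Function.update ω₂ t j) k = a.stage2 (ω₁, ω₂) k := by
  induction k with
  | zero => exact stage2_zero_snd _ _ _
  | succ k ih =>
    have hk' : k < a.K := by omega
    have e : Function.update ω₂ t j ⟨k, hk'⟩ = ω₂ ⟨k, hk'⟩ :=
      Function.update_of_ne (fun h => by rw [← h] at hk; simp at hk) _ _
    rw [stage2_succ _ hk', stage2_succ _ hk', ih (by omega),
      blockStep_snd ω₁ (Function.update ω₂ t j) ω₂]
    dsimp only
    rw [e]

/-- Rate of the second stage, conditionally on the first one, relative to a feasible point of the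
bidual problem. -/
theorem expect_objective_stage2_le [NeZero N] (hP : P.Admissible) (hH : BddAbove P.absValues)
    (ho : P.IsOracle a.orc) (hst : a.ValidStart)
    {y : (i : Fin N) → Vec (P.dim i)} (hy : ∀ i, y i ∈ P.X i)
    (hfeas : ∀ j, ((1 / (N : ℝ)) • ∑ i, P.A i (y i)) j ≤ P.b j)
    (ω₁ : Fin (a.T - 1) → Fin N) (ω₂' : Fin a.K → Fin N) {k : ℕ} (hk : k ≤ a.K) :
    (Finset.expect univ fun ω₂ => a.objective (ω₁, ω₂) (a.stage2 (ω₁, ω₂) k)) ≤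
      max (1 / (N : ℝ) * ∑ i, P.hval i (y i) - P.dual (a.lamBar (ω₁, ω₂'))) 0 ^ 2 +
      (2 * N / (k + 2 * N)) ^ 2 * a.objective (ω₁, ω₂') (a.stage2 (ω₁, ω₂') 0) +
      16 * (P.H ^ 2 + P.Gt ^ 2) / (k + 2 * N) := by
  have hN : (1 : ℝ) ≤ N := by exact_mod_cast NeZero.one_le (n := N)
  set δ := max (1 / (N : ℝ) * ∑ i, P.hval i (y i) - P.dual (a.lamBar (ω₁, ω₂'))) 0 with hδ
  set e₀ := a.objective (ω₁, ω₂') (a.stage2 (ω₁, ω₂') 0) with he₀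
  have he₀nn : 0 ≤ e₀ := objective_nonneg _ _
  induction k with
  | zero =>
    have : ∀ ω₂, a.objective (ω₁, ω₂) (a.stage2 (ω₁, ω₂) 0) = e₀ := fun ω₂ => by
      rw [he₀, objective_snd ω₁ ω₂ ω₂', stage2_zero_snd ω₁ ω₂ ω₂']
    simp only [this, Fintype.expect_const]
    have h2 : (2 * (N : ℝ) / ((0 : ℕ) + 2 * N)) = 1 := by
      rw [Nat.cast_zero, zero_add, div_self (by positivity)]
    rw [h2]
    have h3 : 0 ≤ 16 * (P.H ^ 2 + P.Gt ^ 2) / (((0 : ℕ) : ℝ) + 2 * N) := by positivity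
    nlinarith [sq_nonneg δ]
  | succ k ih =>
    have hk' : k < a.K := by omega
    have ih := ih hk'.le
    have hres := expect_resample_pi (⟨k, hk'⟩ : Fin a.K)
      (fun ω₂ i => a.objective (ω₁, ω₂) (a.blockStep (ω₁, ω₂) k (a.stage2 (ω₁, ω₂) k) i))
      (fun ω₂ j => by
        funext i
        rw [stage2_update_of_le ω₁ ω₂ ⟨k, hk'⟩ j le_rfl,
          blockStep_snd ω₁ (Function.update ω₂ ⟨k, hk'⟩ j) ω₂,
          objective_snd ω₁ (Function.update ω₂ ⟨k, hk'⟩ j) ω₂])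
    have hstep : (Finset.expect univ fun ω₂ => a.objective (ω₁, ω₂) (a.stage2 (ω₁, ω₂) (k + 1))) ≤
        (1 - 2 / (k + 2 * N)) * (Finset.expect univ fun ω₂ =>
          a.objective (ω₁, ω₂) (a.stage2 (ω₁, ω₂) k)) + 2 / (k + 2 * N) * δ ^ 2 +
        16 * (P.H ^ 2 + P.Gt ^ 2) / (k + 2 * N) ^ 2 := by
      simp only [stage2_succ _ hk']
      rw [hres]
      refine (expect_le_expect fun ω₂ _ =>
        expect_objective_blockStep_le hP hH ho hst (ω₁, ω₂) hk'.le hy hfeas).trans (le_of_eq ?_)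
      have : ∀ ω₂, a.lamBar (ω₁, ω₂) = a.lamBar (ω₁, ω₂') := fun ω₂ => lamBar_snd _ _ _
      simp only [this]
      rw [expect_add_distrib, expect_add_distrib, ← mul_expect, Fintype.expect_const,
        Fintype.expect_const]
    refine hstep.trans ?_
    set E := Finset.expect univ fun ω₂ => a.objective (ω₁, ω₂) (a.stage2 (ω₁, ω₂) k)
    set M := P.H ^ 2 + P.Gt ^ 2 with hM
    have hM0 : 0 ≤ M := by positivity
    push_cast
    set n : ℝ := k + 2 * N with hn
    have hk0 : (0 : ℝ) ≤ k := by positivity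
    have hn2 : 2 ≤ n := by linarith
    have e : (k : ℝ) + 1 + 2 * N = n + 1 := by rw [hn]; ring
    rw [e]
    have hc : 0 ≤ 1 - 2 / n := by
      rw [sub_nonneg, div_le_one (by linarith)]; exact hn2
    have h1 := mul_le_mul_of_nonneg_left ih hc
    -- with `n = k + 2N`, both `(2N/n)²` and `16M/n` are supersolutions of the recursion
    have h2 : (1 - 2 / n) * (2 * N / n) ^ 2 ≤ (2 * N / (n + 1)) ^ 2 := by
      rw [div_pow, div_pow, one_sub_div (by linarith), div_mul_div_comm,
        div_le_div_iff₀ (by positivity) (by positivity)]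
      have : (n - 2) * (n + 1) ^ 2 ≤ n * n ^ 2 := by nlinarith
      have h4 : 0 ≤ (2 * (N : ℝ)) ^ 2 := by positivity
      nlinarith
    have h3 : (1 - 2 / n) * (16 * M / n) + 16 * M / n ^ 2 ≤ 16 * M / (n + 1) := by
      have e1 : (1 - 2 / n) * (16 * M / n) + 16 * M / n ^ 2 = 16 * M * ((n - 1) / n ^ 2) := by
        field_simp; ring
      rw [e1, ← mul_one_div (16 * M) (n + 1)]
      have e2 : (n - 1) / n ^ 2 ≤ 1 / (n + 1) := by
        rw [div_le_div_iff₀ (by positivity) (by positivity)]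
        nlinarith
      exact mul_le_mul_of_nonneg_left e2 (by positivity)
    have h4 := mul_le_mul_of_nonneg_right h2 he₀nn
    linarith

theorem expect_sqrt_objective_le [NeZero N] (hP : P.Admissible) (hH : BddAbove P.absValues)
    (ho : P.IsOracle a.orc) (hst : a.ValidStart) (h0 : a.lam0 = 0) (hK : 1 ≤ a.K)
    {lamStar : Vec m} (hs : P.IsDualSolution lamStar) (hv : P.IsBidualValue (P.dual lamStar)) :
    (Finset.expect univ fun ω : a.Sample => √(a.objective ω (a.stage2 ω a.K))) ≤
      (Finset.expect univ fun ω : a.Sample => P.dual lamStar - P.dual (a.lamBar ω)) +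
      2 * N / a.K * (Finset.expect univ fun ω : a.Sample => √(a.objective ω (a.stage2 ω 0))) +
      4 * √(P.H ^ 2 + P.Gt ^ 2) / √a.K := by
  have hK0 : (0 : ℝ) < a.K := by exact_mod_cast hK
  have hN : (1 : ℝ) ≤ N := by exact_mod_cast NeZero.one_le (n := N)
  have hM : 0 ≤ P.H ^ 2 + P.Gt ^ 2 := by positivity
  refine le_of_forall_pos_le_add fun ε hε => ?_
  obtain ⟨_, ⟨y, hy, hfeas, rfl⟩, -, hlt⟩ := hv.exists_between (lt_add_of_pos_right _ hε)
  set B := 1 / (N : ℝ) * ∑ i, P.hval i (y i) with hB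
  -- Jensen's inequality is applied conditionally on the first stage, since only the first
  -- moment of `d* - d(λ̄)` has been bounded
  have hcond : ∀ ω₁,
      (Finset.expect univ fun ω₂ => √(a.objective (ω₁, ω₂) (a.stage2 (ω₁, ω₂) a.K))) ≤
      Finset.expect univ fun ω₂ => (P.dual lamStar - P.dual (a.lamBar (ω₁, ω₂)) +
        2 * N / a.K * √(a.objective (ω₁, ω₂) (a.stage2 (ω₁, ω₂) 0)) +
        4 * √(P.H ^ 2 + P.Gt ^ 2) / √a.K + ε) := by
    intro ω₁
    refine le_expect univ_nonempty fun ω₂' _ => ?_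
    have h1 := expect_objective_stage2_le hP hH ho hst hy hfeas ω₁ ω₂' (le_refl a.K)
    rw [← hB] at h1
    set e₀ := a.objective (ω₁, ω₂') (a.stage2 (ω₁, ω₂') 0) with he₀
    have he₀nn : 0 ≤ e₀ := objective_nonneg _ _
    set Δ := P.dual lamStar - P.dual (a.lamBar (ω₁, ω₂')) with hΔ
    have hΔ0 : 0 ≤ Δ := sub_nonneg.2 (hs.2 _ (lamBar_nonneg h0 _))
    have h2 : max (B - P.dual (a.lamBar (ω₁, ω₂'))) 0 ≤ Δ + ε :=
      max_le (by linarith) (by linarith)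
    have h3 : (Finset.expect univ fun ω₂ => a.objective (ω₁, ω₂) (a.stage2 (ω₁, ω₂) a.K)) ≤
        (Δ + ε) ^ 2 + (2 * N / a.K) ^ 2 * e₀ + 16 * (P.H ^ 2 + P.Gt ^ 2) / a.K := by
      refine h1.trans ?_
      gcongr <;> linarith
    refine (expect_le_sqrt (c := (Δ + ε) ^ 2 + (2 * N / a.K) ^ 2 * e₀ +
      16 * (P.H ^ 2 + P.Gt ^ 2) / a.K) ?_).trans ?_
    · simpa only [Real.sq_sqrt (objective_nonneg _ _)] using h3
    · rw [Real.sqrt_le_iff]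
      have p1 : 0 ≤ 2 * N / a.K * √e₀ := by positivity
      have p2 : 0 ≤ 4 * √(P.H ^ 2 + P.Gt ^ 2) / √a.K := by positivity
      refine ⟨by linarith, ?_⟩
      have q1 : (2 * N / a.K * √e₀) ^ 2 = (2 * N / a.K) ^ 2 * e₀ := by
        rw [mul_pow, Real.sq_sqrt he₀nn]
      have q2 : (4 * √(P.H ^ 2 + P.Gt ^ 2) / √a.K) ^ 2 = 16 * (P.H ^ 2 + P.Gt ^ 2) / a.K := by
        rw [div_pow, mul_pow, Real.sq_sqrt hM, Real.sq_sqrt hK0.le]; norm_num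
      rw [← q1, ← q2]
      have p3 : 0 ≤ Δ + ε := by linarith
      nlinarith [mul_nonneg p1 p2, mul_nonneg p1 p3, mul_nonneg p2 p3]
  have h1 := expect_le_expect (s := univ) fun ω₁ _ => hcond ω₁
  rw [← expect_product' univ univ
      (fun ω₁ ω₂ => √(a.objective (ω₁, ω₂) (a.stage2 (ω₁, ω₂) a.K))),
    ← expect_product' univ univ (fun ω₁ ω₂ => P.dual lamStar - P.dual (a.lamBar (ω₁, ω₂)) +
        2 * N / a.K * √(a.objective (ω₁, ω₂) (a.stage2 (ω₁, ω₂) 0)) +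
        4 * √(P.H ^ 2 + P.Gt ^ 2) / √a.K + ε), univ_product_univ, expect_add_distrib,
    expect_add_distrib, expect_add_distrib, Fintype.expect_const, Fintype.expect_const,
    ← mul_expect] at h1
  exact h1

/-! ### The objective at the start of the second stage -/

theorem gradβ_le_sqrt_objective (ω : a.Sample) (s : Stage2State N m) :
    a.gradβ ω s ≤ √(a.objective ω s) :=
  Real.le_sqrt_of_sq_le (le_add_of_nonneg_right (sq_nonneg _))

theorem normPlus_le_sqrt_objective (ω : a.Sample) (s : Stage2State N m) :
    normPlus (∑ i, s.z i - P.b) ≤ √(a.objective ω s) :=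
  Real.le_sqrt_of_sq_le (le_add_of_nonneg_left (sq_nonneg _))

theorem sqrt_objective_le (ω : a.Sample) (s : Stage2State N m) :
    √(a.objective ω s) ≤ a.gradβ ω s + normPlus (∑ i, s.z i - P.b) := by
  have h1 := gradβ_nonneg ω s
  have h2 := normPlus_nonneg (∑ i, s.z i - P.b)
  rw [Real.sqrt_le_iff, objective]
  exact ⟨by positivity, by nlinarith⟩

theorem sum_β0_eq_blockAvg (hst : a.start = .averages) (ω : a.Sample) :
    ∑ i, a.β0 ω i = a.blockAvg ω (a.stepVal ω) := by
  refine sum_congr rfl fun i _ => ?_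
  simp only [β0, hst, stepVal, smul_eq_mul, ← mul_sum]
  ring

theorem sum_z0_sub_eq_blockAvg [NeZero N] (hst : a.start = .averages) (ω : a.Sample) :
    ∑ i, a.z0 ω i - P.b = a.blockAvg ω (a.stepRes ω) := by
  have hN : (N : ℝ) ≠ 0 := NeZero.ne _
  have hb : P.b = ∑ _i : Fin N, (1 / (N : ℝ)) • P.b := by
    rw [sum_const, card_univ, Fintype.card_fin, ← Nat.cast_smul_eq_nsmul ℝ, smul_smul,
      mul_one_div_cancel hN, one_smul]
  conv_lhs => rw [hb]
  rw [← sum_sub_distrib]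
  refine sum_congr rfl fun i _ => ?_
  have hI : ((a.count ω i : ℝ) + 1) ≠ 0 := by positivity
  simp only [z0, hst, stepRes, sum_sub_distrib, sum_const, map_smul, map_add, map_sum,
    ← Nat.cast_smul_eq_nsmul ℝ]
  rw [← smul_sub]
  congr 1
  have e : P.b = (1 / ((a.count ω i : ℝ) + 1)) • ((a.count ω i : ℝ) + 1) • P.b := by
    rw [smul_smul, one_div_mul_cancel hI, one_smul]
  conv_lhs => rw [e]
  rw [← smul_sub, add_smul, one_smul]
  congr 1
  simp only [count]
  abel

/-- Constant of the dual gap after the first stage. -/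
noncomputable def gapConst (G L Λ : ℝ) : ℝ := G / 2 * (L ^ 2 / Λ + Λ)

/-- Constant of the objective at the start of the second stage from the averages. -/
noncomputable def startConst (G H L Λ : ℝ) : ℝ :=
  2 * (H + G) + (√(2 * H ^ 2 + 2 * G ^ 2 * momentBound L Λ) + Λ * G / 2 +
    G / Λ * √(momentBound L Λ))

theorem expect_sqrt_objective_start_averages_le [NeZero N] (hP : P.Admissible)
    (hH : BddAbove P.absValues)
    (ho : P.IsOracle a.orc) (h0 : a.lam0 = 0) {Λ : ℝ} (hΛ : 0 < Λ) (hT : 1 ≤ a.T)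
    (hα : ∀ t, a.α t = Λ / (P.Gt * √a.T)) {lamStar : Vec m} (hs : P.IsDualSolution lamStar)
    (hst : a.start = .averages) :
    (Finset.expect univ fun ω : a.Sample => √(a.objective ω (a.stage2 ω 0))) ≤
      startConst P.Gt P.H ‖lamStar‖ Λ * (√((N : ℝ) / a.T) + N / a.T) := by
  have hT0 : (0 : ℝ) < a.T := by exact_mod_cast hT
  have hN1 : (1 : ℝ) ≤ N := by exact_mod_cast NeZero.one_le (n := N)
  have hG := Gt_nonneg (P := P)
  have hH0 := H_nonneg (P := P)
  have hpt : ∀ ω : a.Sample, √(a.objective ω (a.stage2 ω 0)) ≤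
      max (1 / (a.T : ℝ) * ∑ t ∈ range a.T, a.sampled ω (a.stepVal ω) t -
        P.dual (a.lamBar ω)) 0 +
      normPlus ((1 / (a.T : ℝ)) • ∑ t ∈ range a.T, a.stepDir ω t) +
      (P.H + P.Gt) * a.deviation ω := by
    intro ω
    refine (sqrt_objective_le _ _).trans ?_
    have e1 : ∑ i, (a.stage2 ω 0).β i = a.blockAvg ω (a.stepVal ω) := sum_β0_eq_blockAvg hst ω
    have e2 : ∑ i, (a.stage2 ω 0).z i - P.b = a.blockAvg ω (a.stepRes ω) :=
      sum_z0_sub_eq_blockAvg hst ω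
    have h1 := norm_blockAvg_sub_le hT ω (v := a.stepVal ω) (c := P.H)
      fun t i => abs_stepVal_le hP hH ho ω t i
    have h2 := norm_blockAvg_sub_le hT ω (v := a.stepRes ω) (c := P.Gt)
      fun t i => norm_stepRes_le hP ho ω t i
    rw [gradβ, e1, e2]
    have h3 : max (a.blockAvg ω (a.stepVal ω) - P.dual (a.lamBar ω)) 0 ≤
        max (1 / (a.T : ℝ) * ∑ t ∈ range a.T, a.sampled ω (a.stepVal ω) t -
          P.dual (a.lamBar ω)) 0 + P.H * a.deviation ω := by
      rw [Real.norm_eq_abs, smul_eq_mul] at h1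
      refine max_le ?_ ?_
      · linarith [le_max_left (1 / (a.T : ℝ) * ∑ t ∈ range a.T, a.sampled ω (a.stepVal ω) t -
          P.dual (a.lamBar ω)) 0, le_abs_self (a.blockAvg ω (a.stepVal ω) -
          1 / (a.T : ℝ) * ∑ t ∈ range a.T, a.sampled ω (a.stepVal ω) t)]
      · exact add_nonneg (le_max_right _ _) ((abs_nonneg _).trans h1)
    have h4 : normPlus (a.blockAvg ω (a.stepRes ω)) ≤
        normPlus ((1 / (a.T : ℝ)) • ∑ t ∈ range a.T, a.stepDir ω t) + P.Gt * a.deviation ω := by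
      have := normPlus_add_le ((1 / (a.T : ℝ)) • ∑ t ∈ range a.T, a.stepDir ω t)
        (a.blockAvg ω (a.stepRes ω) - (1 / (a.T : ℝ)) • ∑ t ∈ range a.T, a.stepDir ω t)
      rw [add_sub_cancel] at this
      exact this.trans (add_le_add_right h2 _)
    linarith
  have h1 := expect_le_expect (s := univ) fun ω _ => hpt ω
  rw [expect_add_distrib, expect_add_distrib, ← mul_expect] at h1
  have h2 := expect_sampled_val_sub_dual_le hP hH ho h0 hΛ hT hα hs
  have h3 := expect_normPlus_avg_stepDir_le hP hH ho h0 hΛ hT hα hs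
  have h4 := mul_le_mul_of_nonneg_left (expect_deviation_le (a := a) hT)
    (add_nonneg hH0 hG)
  set c := √(2 * P.H ^ 2 + 2 * P.Gt ^ 2 * momentBound ‖lamStar‖ Λ) + Λ * P.Gt / 2 with hc
  have hc0 : 0 ≤ c + P.Gt / Λ * √(momentBound ‖lamStar‖ Λ) := by positivity
  set S := √((N : ℝ) / a.T) with hS
  have hS1 : 1 / √(a.T : ℝ) ≤ S := by
    rw [hS, Real.sqrt_div' _ hT0.le]
    gcongr
    rwa [Real.one_le_sqrt]
  have hu : 0 ≤ (N : ℝ) / a.T := by positivity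
  have h5 := mul_le_mul_of_nonneg_left hS1 hc0
  have h6 : c / √(a.T : ℝ) + P.Gt / Λ * √(momentBound ‖lamStar‖ Λ) / √a.T =
      (c + P.Gt / Λ * √(momentBound ‖lamStar‖ Λ)) * (1 / √(a.T : ℝ)) := by ring
  have h7 : startConst P.Gt P.H ‖lamStar‖ Λ =
    2 * (P.H + P.Gt) + (c + P.Gt / Λ * √(momentBound ‖lamStar‖ Λ)) := rfl
  rw [h7]
  have h8 : 0 ≤ (P.H + P.Gt) * S := by positivity
  have h9 := mul_nonneg hc0 hu
  nlinarith

theorem expect_sqrt_objective_start_points_le [NeZero N] (hP : P.Admissible)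
    (hH : BddAbove P.absValues)
    (ho : P.IsOracle a.orc) (h0 : a.lam0 = 0) {Λ : ℝ} (hΛ : 0 < Λ) (hT : 1 ≤ a.T)
    (hα : ∀ t, a.α t = Λ / (P.Gt * √a.T)) {lamStar : Vec m} (hs : P.IsDualSolution lamStar)
    {x0 : (i : Fin N) → Vec (P.dim i)} (hx0 : ∀ i, x0 i ∈ P.X i) (hst : a.start = .points x0) :
    (Finset.expect univ fun ω : a.Sample => √(a.objective ω (a.stage2 ω 0))) ≤
      2 * P.H + P.Gt + gapConst P.Gt ‖lamStar‖ Λ := by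
  have hN : (N : ℝ) ≠ 0 := NeZero.ne _
  have hG := Gt_nonneg (P := P)
  have hH0 := H_nonneg (P := P)
  have hdual : -P.H ≤ P.dual lamStar := by
    refine le_trans ?_ (hs.2 0 fun j => le_rfl)
    rw [dual_eq_expect hP ho]
    refine le_expect univ_nonempty fun i _ => ?_
    rw [inner_zero_left, add_zero]
    exact (abs_le.1 (abs_hval_le_H hH (ho.mem_X hP i zero_le_one 0))).1
  have hpt : ∀ ω : a.Sample, √(a.objective ω (a.stage2 ω 0)) ≤
      (P.dual lamStar - P.dual (a.lamBar ω)) + (2 * P.H + P.Gt) := by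
    intro ω
    refine (sqrt_objective_le _ _).trans ?_
    have e1 : ∑ i, (a.stage2 ω 0).β i = (1 / (N : ℝ)) • ∑ i, P.hval i (x0 i) := by
      simp only [stage2, β0, hst, ← mul_sum, smul_eq_mul]
    have e2 : ∑ i, (a.stage2 ω 0).z i - P.b = (1 / (N : ℝ)) • ∑ i, (P.A i (x0 i) - P.b) := by
      simp only [stage2, z0, hst, ← smul_sum]
      rw [sum_sub_distrib, smul_sub, sum_const, card_univ, Fintype.card_fin,
        ← Nat.cast_smul_eq_nsmul ℝ, smul_smul, one_div_mul_cancel hN, one_smul]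
    have h1 : (1 / (N : ℝ)) • ∑ i, P.hval i (x0 i) ≤ P.H :=
      (le_abs_self _).trans (norm_avg_le (v := fun i => P.hval i (x0 i))
        fun i => abs_hval_le_H hH (hx0 i))
    have h2 : normPlus ((1 / (N : ℝ)) • ∑ i, (P.A i (x0 i) - P.b)) ≤ P.Gt :=
      (normPlus_le_norm _).trans (norm_avg_le fun i => hP.norm_sub_le_Gt (hx0 i))
    have h3 := hs.2 _ (lamBar_nonneg h0 ω)
    rw [gradβ, e1, e2]
    have h4 : max ((1 / (N : ℝ)) • ∑ i, P.hval i (x0 i) - P.dual (a.lamBar ω)) 0 ≤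
        (P.dual lamStar - P.dual (a.lamBar ω)) + 2 * P.H :=
      max_le (by linarith) (by linarith)
    linarith
  refine (expect_le_expect fun ω _ => hpt ω).trans ?_
  rw [expect_add_distrib, Fintype.expect_const, add_comm]
  gcongr
  refine (expect_dual_gap_le hP hH ho h0 hΛ hT hα hs).trans ?_
  refine div_le_self (by positivity) ?_
  rw [Real.one_le_sqrt]
  exact_mod_cast hT

/-! ### Decomposition and reconstruction -/

theorem exists_isOutput [NeZero N] (ho : P.IsOracle a.orc) (hst : a.ValidStart) (ω : a.Sample) :
    ∃ xbar, a.IsOutput ω xbar := by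
  classical
  choose w h1 h2 h3 h4 h5 using fun i => isBlockCombination_stage2 (a := a) ω le_rfl i
  set v : Fin N × a.Label → ℝ × Vec m × (Fin N → ℝ) := fun q =>
    (1 / (N : ℝ) * P.fval q.1 (a.pt ω q.1 q.2), (1 / (N : ℝ)) • P.A q.1 (a.pt ω q.1 q.2),
      Pi.single q.1 1) with hv
  obtain ⟨w', g1, g2, g3, g4⟩ := exists_conic_card_le_finrank v (fun q => w q.1 q.2)
    fun q => h1 q.1 q.2
  have hsum : ∀ u : Fin N × a.Label → ℝ, ∑ q, u q • v q =
      (∑ i, ∑ l, u (i, l) * (1 / (N : ℝ) * P.fval i (a.pt ω i l)),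
        ∑ i, ∑ l, u (i, l) • (1 / (N : ℝ)) • P.A i (a.pt ω i l), fun i => ∑ l, u (i, l)) := by
    intro u
    refine Prod.ext ?_ (Prod.ext ?_ ?_)
    · rw [Prod.fst_sum, Fintype.sum_prod_type]
      rfl
    · rw [Prod.snd_sum, Prod.fst_sum, Fintype.sum_prod_type]
      rfl
    · rw [Prod.snd_sum, Prod.snd_sum, Fintype.sum_prod_type]
      funext i
      simp only [hv, Prod.smul_mk, Finset.sum_apply, Pi.smul_apply, smul_eq_mul]
      rw [sum_eq_single i]
      · simp
      · intro j _ hj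
        simp [hj.symm]
      · simp
  rw [hsum, hsum] at g3
  obtain ⟨k1, k2⟩ := Prod.ext_iff.1 g3
  obtain ⟨k2, k3⟩ := Prod.ext_iff.1 k2
  refine ⟨_, fun i l => w' (i, l),
    ⟨fun i l => g1 _, fun i l hl => g2 _ (h2 i l hl), ?_, ?_, ?_, ?_⟩,
    fun i => rfl⟩
  · refine Eq.trans k1 ?_
    rw [βK]
    dsimp only
    refine sum_congr rfl fun i _ => ?_
    rw [h4 i]
    exact sum_congr rfl fun l _ => by rw [fval_pt ho hst]
  · refine Eq.trans k2 ?_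
    rw [zK]
    dsimp only
    exact sum_congr rfl fun i _ => (h5 i).symm
  · intro i
    exact (congrFun k3 i).trans (h3 i)
  · have e : {q : Fin N × a.Label | w' (q.1, q.2) ≠ 0} =
        (univ.filter fun q => w' q ≠ 0 : Finset _) := by
      ext q; simp
    rw [e, Set.ncard_coe_finset]
    refine g4.trans (le_of_eq ?_)
    simp only [Module.finrank_prod, Module.finrank_self, finrank_euclideanSpace,
      Module.finrank_fintype_fun_eq_card, Fintype.card_fin]
    omega

/-- A convex combination increases the function by at most `ρ`. -/
theorem fval_sum_le (hP : P.Admissible) {i : Fin N} {r : ℝ} (hr : rho (P.f i) ≤ r)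
    {ι : Type*} [Fintype ι] {w : ι → ℝ} {x : ι → Vec (P.dim i)} (hw : ∀ l, 0 ≤ w l)
    (hw1 : ∑ l, w l = 1) (hx : ∀ l, x l ∈ dom (P.f i)) :
    P.fval i (∑ l, w l • x l) ≤ ∑ l, w l * P.fval i (x l) + r := by
  have hmem : ∑ l, w l • x l ∈ dom (P.f i) :=
    (hP.convex_dom i).sum_mem (fun l _ => hw l) hw1 fun l _ => hx l
  have e := (Fintype.equivFin ι).symm
  have h1 : P.f i (∑ l, w l • x l) - ((∑ l, w l * P.fval i (x l) : ℝ) : EReal) ≤ rho (P.f i) := by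
    refine le_sSup ⟨Fintype.card ι, fun j => w (e j), fun j => x (e j), fun j => hw _, ?_,
      fun j => hx _, ?_⟩
    · rw [Equiv.sum_comp e, hw1]
    · rw [Equiv.sum_comp e (fun l => w l • x l),
        Equiv.sum_comp e (fun l => w l * (P.f i (x l)).toReal)]
      rfl
  have h2 := h1.trans hr
  rw [← EReal.coe_toReal (ne_of_lt hmem) (hP.ne_bot i _), ← EReal.coe_sub,
    EReal.coe_le_coe_iff] at h2
  change P.fval i _ - _ ≤ r at h2
  linarith

theorem rho_nonneg (hP : P.Admissible) (i : Fin N) : 0 ≤ rho (P.f i) := by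
  obtain ⟨x, hx⟩ := hP.nonempty_dom i
  refine le_sSup ⟨1, fun _ => 1, fun _ => x, by simp, by simp, fun _ => hx, ?_⟩
  simp only [univ_unique, one_smul, sum_singleton, one_mul]
  rw [EReal.coe_toReal (ne_of_lt hx) (hP.ne_bot i x), EReal.sub_self (ne_of_lt hx) (hP.ne_bot i x)]

/-- At most `m + 1` blocks of a decomposition have several nonzero coefficients. -/
theorem IsCaratheodory.card_le_succ {ω : a.Sample} {w : Fin N → a.Label → ℝ}
    (hw : a.IsCaratheodory ω w) :
    (univ.filter fun i => 1 < (univ.filter fun l => w i l ≠ 0).card).card ≤ m + 1 := by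
  classical
  have h1 : ∑ i, (univ.filter fun l => w i l ≠ 0).card ≤ 1 + m + N := by
    refine le_trans (le_of_eq ?_) hw.card_le
    have e : {q : Fin N × a.Label | w q.1 q.2 ≠ 0} =
        (univ.filter fun q : Fin N × a.Label => w q.1 q.2 ≠ 0 : Finset _) := by
      ext q; simp
    rw [e, Set.ncard_coe_finset, card_filter, Fintype.sum_prod_type]
    exact sum_congr rfl fun i _ => card_filter _ _
  have h2 : ∀ i, 1 + (if 1 < (univ.filter fun l => w i l ≠ 0).card then 1 else 0) ≤
      (univ.filter fun l => w i l ≠ 0).card := by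
    intro i
    have : 0 < (univ.filter fun l => w i l ≠ 0).card := by
      rw [card_pos]
      by_contra h
      rw [not_nonempty_iff_eq_empty, filter_eq_empty_iff] at h
      have h3 := hw.sum_one i
      rw [sum_eq_zero fun l hl => not_not.1 (h hl)] at h3
      exact zero_ne_one h3
    split <;> omega
  have h3 := sum_le_sum fun i (_ : i ∈ univ) => h2 i
  rw [sum_add_distrib, ← card_filter, sum_const, card_univ, Fintype.card_fin] at h3
  simp only [smul_eq_mul, mul_one] at h3
  omega

/-- The reconstruction pays the nonconvexity `ρ` only in the blocks with several nonzero
coefficients. -/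
theorem IsCaratheodory.avg_fval_le [NeZero N] (hP : P.Admissible) (ho : P.IsOracle a.orc)
    (hst : a.ValidStart) {ω : a.Sample} {w : Fin N → a.Label → ℝ} (hw : a.IsCaratheodory ω w)
    {r : ℝ} (hr : ∀ i, rho (P.f i) ≤ r) :
    1 / (N : ℝ) * ∑ i, P.fval i (∑ l, w i l • a.pt ω i l) ≤ a.βK ω + (m + 1) / N * r := by
  classical
  have hN : (0 : ℝ) < N := by exact_mod_cast NeZero.pos N
  have hr0 : 0 ≤ r := by
    have := (rho_nonneg hP (0 : Fin N)).trans (hr 0)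
    exact_mod_cast this
  have hblock : ∀ i, P.fval i (∑ l, w i l • a.pt ω i l) ≤
      ∑ l, w i l * P.fval i (a.pt ω i l) +
        if 1 < (univ.filter fun l => w i l ≠ 0).card then r else 0 := by
    intro i
    split_ifs with h
    · exact fval_sum_le hP (hr i) (hw.nonneg i) (hw.sum_one i) fun l => (pt_spec ho hst ω i l).1
    · obtain ⟨l₀, hl₀⟩ : ∃ l₀, ∀ l, l ≠ l₀ → w i l = 0 := by
        rcases (Nat.le_one_iff_eq_zero_or_eq_one.1 (not_lt.1 h)) with h | h
        · rw [card_eq_zero, filter_eq_empty_iff] at h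
          exact ⟨.inl none, fun l _ => not_not.1 (h (mem_univ l))⟩
        · obtain ⟨l₀, hl₀⟩ := card_eq_one.1 h
          refine ⟨l₀, fun l hl => ?_⟩
          by_contra h'
          have : l ∈ univ.filter fun l => w i l ≠ 0 := by simpa using h'
          rw [hl₀, mem_singleton] at this
          exact hl this
      have h1 : w i l₀ = 1 := by
        rw [← hw.sum_one i, sum_eq_single l₀ (fun l _ hl => hl₀ l hl) (by simp)]
      rw [sum_eq_single l₀ (fun l _ hl => by rw [hl₀ l hl, zero_smul]) (by simp),
        sum_eq_single l₀ (fun l _ hl => by rw [hl₀ l hl, zero_mul]) (by simp), h1, one_smul,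
        one_mul, add_zero]
  have h1 := sum_le_sum fun i (_ : i ∈ univ) => hblock i
  rw [sum_add_distrib, ← sum_filter, sum_const, nsmul_eq_mul] at h1
  have h2 :
      ((univ.filter fun i => 1 < (univ.filter fun l => w i l ≠ 0).card).card : ℝ) ≤ m + 1 := by
    exact_mod_cast hw.card_le_succ
  have h3 := mul_le_mul_of_nonneg_right h2 hr0
  have h4 : a.βK ω = 1 / (N : ℝ) * ∑ i, ∑ l, w i l * P.fval i (a.pt ω i l) := by
    rw [← hw.sum_β, mul_sum]
    refine sum_congr rfl fun i _ => ?_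
    rw [mul_sum]
    exact sum_congr rfl fun l _ => by ring
  have h5 : (m + 1) / (N : ℝ) * r = 1 / (N : ℝ) * ((m + 1) * r) := by ring
  rw [h4, h5, ← mul_add]
  gcongr
  linarith

theorem IsCaratheodory.avg_A_eq {ω : a.Sample} {w : Fin N → a.Label → ℝ}
    (hw : a.IsCaratheodory ω w) :
    (1 / (N : ℝ)) • ∑ i, P.A i (∑ l, w i l • a.pt ω i l) = a.zK ω := by
  rw [← hw.sum_z, smul_sum]
  refine sum_congr rfl fun i _ => ?_
  rw [map_sum, smul_sum]
  exact sum_congr rfl fun l _ => by rw [map_smul, smul_comm]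

/-- A bound on the expected root of the final objective is a guarantee. -/
theorem guarantee_of_expect_sqrt_objective_le [NeZero N] (hP : P.Admissible)
    (ho : P.IsOracle a.orc) (hst : a.ValidStart) (h0 : a.lam0 = 0)
    {lamStar : Vec m} (hs : P.IsDualSolution lamStar) {e : ℝ}
    (he : (Finset.expect univ fun ω : a.Sample => √(a.objective ω (a.stage2 ω a.K))) ≤ e) :
    a.Guarantee (P.dual lamStar) e := by
  have hN : (0 : ℝ) < N := by exact_mod_cast NeZero.pos N
  refine ⟨exists_isOutput ho hst, fun xbar hx => ?_⟩
  choose w hw hxw using hx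
  refine ⟨fun ω i => ?_, ?_, ?_⟩
  · rw [hxw]
    exact (hP.convex_dom i).sum_mem (fun l _ => (hw ω).nonneg i l) ((hw ω).sum_one i)
      fun l _ => (pt_spec ho hst ω i l).1
  · have hc : (0 : ℝ) < (m + 1) / N := by positivity
    have hsup : 0 ≤ ⨆ i, rho (P.f i) := (rho_nonneg hP 0).trans (le_iSup (fun i => rho (P.f i)) 0)
    induction hR : (⨆ i, rho (P.f i)) with
    | bot => rw [hR] at hsup; exact absurd hsup (by simp)
    | top =>
      rw [EReal.coe_mul_top_of_pos hc, EReal.top_add_coe]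
      exact le_top
    | coe r =>
      rw [← EReal.coe_mul, ← EReal.coe_add, EReal.coe_le_coe_iff]
      have hr : ∀ i, rho (P.f i) ≤ r := fun i => hR ▸ le_iSup (fun i => rho (P.f i)) i
      have hpt : ∀ ω : a.Sample, 1 / (N : ℝ) * ∑ i, P.fval i (xbar ω i) - P.dual lamStar ≤
          √(a.objective ω (a.stage2 ω a.K)) + (m + 1) / N * r := by
        intro ω
        have h1 := (hw ω).avg_fval_le hP ho hst hr
        simp only [← hxw] at h1
        have h2 := hs.2 _ (lamBar_nonneg h0 ω)
        have h3 := gradβ_le_sqrt_objective ω (a.stage2 ω a.K)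
        have h4 : a.βK ω - P.dual (a.lamBar ω) ≤ a.gradβ ω (a.stage2 ω a.K) := le_max_left _ _
        linarith
      refine (expect_le_expect fun ω _ => hpt ω).trans ?_
      rw [expect_add_distrib, Fintype.expect_const]
      linarith
  · refine (expect_le_expect fun ω _ => ?_).trans he
    simp only [hxw]
    rw [(hw ω).avg_A_eq]
    exact normPlus_le_sqrt_objective ω (a.stage2 ω a.K)

/-! ### Oracle calls -/

theorem stage1_calls (ω : a.Sample) {t : ℕ} (ht : t ≤ a.T - 1) : (a.stage1 ω t).calls = t := by
  induction t with
  | zero => rfl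
  | succ t ih =>
    rw [stage1]
    simp only [show t < a.T - 1 by omega, dif_pos, ih (by omega)]

theorem stage2_calls (ω : a.Sample) {k : ℕ} (hk : k ≤ a.K) : (a.stage2 ω k).calls = k := by
  induction k with
  | zero => rfl
  | succ k ih => rw [stage2_succ ω (show k < a.K by omega), blockStep, ih (by omega)]

theorem totalCalls_eq (hT : 1 ≤ a.T) (ω : a.Sample) :
    a.totalCalls ω = (a.T - 1 + N) + N + a.K := by
  have h : (a.stage1 ω (a.T - 1 + 1)).calls = a.T - 1 + N := by
    rw [stage1]
    simp only [lt_irrefl, dif_neg, not_false_eq_true, stage1_calls ω le_rfl]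
  rw [totalCalls, stage2_calls ω le_rfl]
  rw [show a.T - 1 + 1 = a.T by omega] at h
  rw [h]

end Problem.Algo

/-! ### Choice of the constants -/

open Problem.Algo

theorem gapConst_nonneg {G L Λ : ℝ} (hG : 0 ≤ G) (hΛ : 0 < Λ) : 0 ≤ gapConst G L Λ := by
  unfold gapConst; positivity

theorem startConst_nonneg {G H L Λ : ℝ} (hG : 0 ≤ G) (hH : 0 ≤ H) (hΛ : 0 < Λ) :
    0 ≤ startConst G H L Λ := by
  unfold startConst; positivity

/-- The constant for the start from the averages. -/
noncomputable def averagesConst (G H L Λ : ℝ) : ℝ :=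
  gapConst G L Λ + 2 * startConst G H L Λ + 4 * √(H ^ 2 + G ^ 2)

/-- The constant for the start from arbitrary points. -/
noncomputable def pointsConst (N : ℕ) (G H L Λ : ℝ) : ℝ :=
  gapConst G L Λ + 2 * N * (2 * H + G + gapConst G L Λ) + 4 * √(H ^ 2 + G ^ 2)

/-- The constant of the complexity bound for accuracies up to `ε₀`, if the rate has constant `c`. -/
noncomputable def complexityConst (c ε₀ : ℝ) : ℝ :=
  2 * (16 * (c + 1) ^ 2 + ε₀ ^ 2) +
    2 * (2 * (c + 1) * (1 + ε₀ ^ (1 / 3 : ℝ)) + (ε₀ ^ (1 / 3 : ℝ)) ^ 2)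

/-- A number `T = K` of iterations for which the rate is below `ε` and the number of oracle calls is
of the order of the complexity bound. -/
theorem exists_iterations (N : ℕ) {c ε₀ ε : ℝ} (hc : 0 ≤ c) (hε : 0 < ε) (hε₀ : ε ≤ ε₀) :
    ∃ T : ℕ, 1 ≤ T ∧ c * rate N T T ≤ ε ∧
      2 * (T : ℝ) - 1 + 2 * N ≤ complexityConst c ε₀ * complexity N ε := by
  have hε₀' : 0 < ε₀ := hε.trans_le hε₀
  set e := ε ^ (1 / 3 : ℝ) with he
  set e₀ := ε₀ ^ (1 / 3 : ℝ) with he₀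
  have hepos : 0 < e := Real.rpow_pos_of_pos hε _
  have hee : e ≤ e₀ := Real.rpow_le_rpow hε.le hε₀ (by norm_num)
  have he3 : e ^ 3 = ε := by
    rw [he, ← Real.rpow_natCast, ← Real.rpow_mul hε.le]; norm_num
  have he2 : ε ^ (2 / 3 : ℝ) = e ^ 2 := by
    rw [he, ← Real.rpow_natCast, ← Real.rpow_mul hε.le]; norm_num
  set b := 2 * (c + 1) * (1 + e₀) with hb
  have hb2 : 1 ≤ b := by
    have : 0 ≤ e₀ := by linarith
    nlinarith
  have hN : (0 : ℝ) ≤ N := by positivity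
  -- the first summand makes `2/√T` of order `ε`, the second one makes `(N/T)^(3/2)` and `(N/T)²` so
  set q := 16 * (c + 1) ^ 2 / ε ^ 2 + b * N / e ^ 2 with hq
  have hqa : 0 < 16 * (c + 1) ^ 2 / ε ^ 2 := by positivity
  have hqb : 0 ≤ b * N / e ^ 2 := by positivity
  have hTq := Nat.le_ceil q
  have hTq' := Nat.ceil_lt_add_one (show 0 ≤ q by positivity)
  set T := ⌈q⌉₊ with hT
  have hT1 : 1 ≤ T := Nat.one_le_ceil_iff.2 (by positivity)
  have hT0 : (0 : ℝ) < T := by exact_mod_cast hT1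
  have hsT : 4 * (c + 1) / ε ≤ √(T : ℝ) := by
    refine Real.le_sqrt_of_sq_le ?_
    have : (4 * (c + 1) / ε) ^ 2 = 16 * (c + 1) ^ 2 / ε ^ 2 := by rw [div_pow, mul_pow]; norm_num
    linarith
  have hu : (N : ℝ) / T ≤ e ^ 2 / b := by
    rw [div_le_div_iff₀ hT0 (by positivity)]
    have h1 : b * N / e ^ 2 ≤ T := by linarith
    rw [div_le_iff₀ (by positivity)] at h1
    linarith
  have hu0 : 0 ≤ (N : ℝ) / T := by positivity
  refine ⟨T, hT1, ?_, ?_⟩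
  · have h1 : (c + 1) * (1 / √(T : ℝ)) ≤ ε / 4 := by
      have h0 : 0 < 4 * (c + 1) / ε := by positivity
      calc (c + 1) * (1 / √(T : ℝ)) ≤ (c + 1) * (1 / (4 * (c + 1) / ε)) := by gcongr
        _ = ε / 4 := by field_simp
    have hub : (N : ℝ) / T ≤ e ^ 2 := hu.trans (div_le_self (by positivity) hb2)
    have h2 : √((N : ℝ) / T) ≤ e := (Real.sqrt_le_sqrt hub).trans (by rw [Real.sqrt_sq hepos.le])
    have h3 : (c + 1) * ((N : ℝ) / T * (√((N : ℝ) / T) + N / T)) ≤ ε / 2 := by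
      have h4 : √((N : ℝ) / T) + N / T ≤ e * (1 + e₀) := by nlinarith
      calc (c + 1) * ((N : ℝ) / T * (√((N : ℝ) / T) + N / T)) ≤
            (c + 1) * (e ^ 2 / b * (e * (1 + e₀))) := by gcongr
        _ = ε / 2 := by
          rw [hb, ← he3]
          have : 1 + e₀ ≠ 0 := by linarith
          have : c + 1 ≠ 0 := by linarith
          field_simp
    have hr : 0 ≤ rate N T T := by unfold rate; positivity
    have h5 : (c + 1) * rate N T T ≤ ε := by
      rw [rate]; linarith
    linarith
  · rw [complexity, he2, complexityConst, ← he₀, ← hb]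
    have h1 : 1 ≤ ε₀ ^ 2 / ε ^ 2 := by
      rw [one_le_div (by positivity)]; gcongr
    have h2 : (N : ℝ) ≤ e₀ ^ 2 * (N / e ^ 2) := by
      rw [mul_div_assoc', le_div_iff₀ (by positivity), mul_comm]; gcongr
    have h3 : 0 ≤ e₀ ^ 2 * (1 / ε ^ 2) := by positivity
    have h4 : 0 ≤ b * (1 / ε ^ 2) := by positivity
    have h5 : 0 ≤ (16 * (c + 1) ^ 2 + ε₀ ^ 2) * (N / e ^ 2) := by positivity
    have h6 : q = 16 * (c + 1) ^ 2 * (1 / ε ^ 2) + b * (N / e ^ 2) := by rw [hq]; ring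
    have h7 : ε₀ ^ 2 / ε ^ 2 = ε₀ ^ 2 * (1 / ε ^ 2) := by ring
    nlinarith

section

variable {P : Problem N m} {orc : (i : Fin N) → ℝ → Vec m → Vec (P.dim i)}
  {lamStar : Vec m} {Λ : ℝ} {T K : ℕ}

theorem guarantee_twoStage_averages [NeZero N] (hP : P.Admissible) (hH : BddAbove P.absValues)
    (ho : P.IsOracle orc) (hs : P.IsDualSolution lamStar) (hv : P.IsBidualValue (P.dual lamStar))
    (hΛ : 0 < Λ) (hT : 1 ≤ T) (hK : 1 ≤ K) :
    (twoStage P orc Λ T K .averages).Guarantee (P.dual lamStar)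
      (averagesConst P.Gt P.H ‖lamStar‖ Λ * rate N T K) := by
  have hG := Problem.Gt_nonneg (P := P)
  have hst : (twoStage P orc Λ T K .averages).ValidStart := fun x0 h => nomatch h
  refine guarantee_of_expect_sqrt_objective_le hP ho hst rfl hs ?_
  have h1 := expect_sqrt_objective_le (a := twoStage P orc Λ T K .averages)
    hP hH ho hst rfl hK hs hv
  have h2 := expect_sqrt_objective_start_averages_le (a := twoStage P orc Λ T K .averages)
    hP hH ho rfl hΛ hT (fun _ => rfl) hs rfl
  have h3 := expect_dual_gap_le (a := twoStage P orc Λ T K .averages)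
    hP hH ho rfl hΛ hT (fun _ => rfl) hs
  change _ ≤ gapConst P.Gt ‖lamStar‖ Λ / √(T : ℝ) at h3
  change _ ≤ startConst P.Gt P.H ‖lamStar‖ Λ * (√((N : ℝ) / T) + N / T) at h2
  change _ ≤ _ + 2 * (N : ℝ) / K * _ + 4 * √(P.H ^ 2 + P.Gt ^ 2) / √(K : ℝ) at h1
  have h4 := mul_le_mul_of_nonneg_left h2 (by positivity : 0 ≤ 2 * (N : ℝ) / K)
  refine (h1.trans (add_le_add (add_le_add h3 h4) le_rfl)).trans ?_
  have g1 := gapConst_nonneg (L := ‖lamStar‖) hG hΛ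
  have g2 := startConst_nonneg (L := ‖lamStar‖) hG (Problem.H_nonneg (P := P)) hΛ
  set c1 := gapConst P.Gt ‖lamStar‖ Λ
  set c3 := startConst P.Gt P.H ‖lamStar‖ Λ
  have e : averagesConst P.Gt P.H ‖lamStar‖ Λ = c1 + 2 * c3 + 4 * √(P.H ^ 2 + P.Gt ^ 2) := rfl
  rw [e, rate]
  have r1 : 0 ≤ 1 / √(T : ℝ) := by positivity
  have r2 : 0 ≤ 1 / √(K : ℝ) := by positivity
  have r3 : 0 ≤ (N : ℝ) / K * (√((N : ℝ) / T) + N / T) := by positivity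
  have e1 : c1 / √(T : ℝ) + 2 * (N : ℝ) / K * (c3 * (√((N : ℝ) / T) + N / T)) +
      4 * √(P.H ^ 2 + P.Gt ^ 2) / √(K : ℝ) = c1 * (1 / √(T : ℝ)) +
      2 * c3 * ((N : ℝ) / K * (√((N : ℝ) / T) + N / T)) +
      4 * √(P.H ^ 2 + P.Gt ^ 2) * (1 / √(K : ℝ)) := by ring
  rw [e1]
  have g3 : 0 ≤ 4 * √(P.H ^ 2 + P.Gt ^ 2) := by positivity
  generalize 1 / √(T : ℝ) = u1 at *
  generalize 1 / √(K : ℝ) = u2 at *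
  generalize (N : ℝ) / K * (√((N : ℝ) / T) + N / T) = u3 at *
  nlinarith [mul_nonneg g1 r2, mul_nonneg g1 r3, mul_nonneg g2 r1, mul_nonneg g2 r2,
    mul_nonneg g3 r1, mul_nonneg g3 r3]

theorem guarantee_twoStage_points [NeZero N] (hP : P.Admissible) (hH : BddAbove P.absValues)
    (ho : P.IsOracle orc) (hs : P.IsDualSolution lamStar) (hv : P.IsBidualValue (P.dual lamStar))
    (hΛ : 0 < Λ) (hT : 1 ≤ T) (hK : 1 ≤ K) {x0 : (i : Fin N) → Vec (P.dim i)}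
    (hx0 : ∀ i, x0 i ∈ dom (P.f i) ∧ P.f i (x0 i) = biconj (P.f i) (x0 i)) :
    (twoStage P orc Λ T K (.points x0)).Guarantee (P.dual lamStar)
      (pointsConst N P.Gt P.H ‖lamStar‖ Λ * rate N T K) := by
  have hG := Problem.Gt_nonneg (P := P)
  have hH0 := Problem.H_nonneg (P := P)
  have hst : (twoStage P orc Λ T K (.points x0)).ValidStart := fun x0' h => by
    cases h; exact hx0
  refine guarantee_of_expect_sqrt_objective_le hP ho hst rfl hs ?_
  have h1 := expect_sqrt_objective_le (a := twoStage P orc Λ T K (.points x0))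
    hP hH ho hst rfl hK hs hv
  have h2 := expect_sqrt_objective_start_points_le (a := twoStage P orc Λ T K (.points x0))
    hP hH ho rfl hΛ hT (fun _ => rfl) hs (fun i => by rw [hP.X_eq]; exact (hx0 i).1) rfl
  have h3 := expect_dual_gap_le (a := twoStage P orc Λ T K (.points x0))
    hP hH ho rfl hΛ hT (fun _ => rfl) hs
  change _ ≤ gapConst P.Gt ‖lamStar‖ Λ / √(T : ℝ) at h3
  change _ ≤ _ + 2 * (N : ℝ) / K * _ + 4 * √(P.H ^ 2 + P.Gt ^ 2) / √(K : ℝ) at h1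
  have h4 := mul_le_mul_of_nonneg_left h2 (by positivity : 0 ≤ 2 * (N : ℝ) / K)
  refine (h1.trans (add_le_add (add_le_add h3 h4) le_rfl)).trans ?_
  have g1 := gapConst_nonneg (L := ‖lamStar‖) hG hΛ
  set c1 := gapConst P.Gt ‖lamStar‖ Λ
  have hK1 : (1 : ℝ) ≤ K := by exact_mod_cast hK
  have hK2 : 1 / (K : ℝ) ≤ 1 / √(K : ℝ) := by
    gcongr
    rw [Real.sqrt_le_left (by positivity)]
    nlinarith
  have g2 : 0 ≤ 2 * (N : ℝ) * (2 * P.H + P.Gt + c1) := by positivity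
  have e : pointsConst N P.Gt P.H ‖lamStar‖ Λ =
      c1 + 2 * N * (2 * P.H + P.Gt + c1) + 4 * √(P.H ^ 2 + P.Gt ^ 2) := rfl
  rw [e, rate]
  have r1 : 0 ≤ 1 / √(T : ℝ) := by positivity
  have r2 : 0 ≤ 1 / √(K : ℝ) := by positivity
  have r3 : 0 ≤ (N : ℝ) / K * (√((N : ℝ) / T) + N / T) := by positivity
  have e1 : c1 / √(T : ℝ) + 2 * (N : ℝ) / K * (2 * P.H + P.Gt + c1) +
      4 * √(P.H ^ 2 + P.Gt ^ 2) / √(K : ℝ) = c1 * (1 / √(T : ℝ)) +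
      2 * (N : ℝ) * (2 * P.H + P.Gt + c1) * (1 / K) +
      4 * √(P.H ^ 2 + P.Gt ^ 2) * (1 / √(K : ℝ)) := by ring
  rw [e1]
  have g3 : 0 ≤ 4 * √(P.H ^ 2 + P.Gt ^ 2) := by positivity
  have h5 := mul_le_mul_of_nonneg_left hK2 g2
  generalize 1 / √(T : ℝ) = u1 at *
  generalize 1 / √(K : ℝ) = u2 at *
  generalize (N : ℝ) / K * (√((N : ℝ) / T) + N / T) = u3 at *
  nlinarith [mul_nonneg g1 r2, mul_nonneg g1 r3, mul_nonneg g2 r1, mul_nonneg g2 r3,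
    mul_nonneg g3 r1, mul_nonneg g3 r3]

theorem totalCalls_twoStage_le (hT : 1 ≤ T) (start : P.Start)
    (ω : (twoStage P orc Λ T T start).Sample) {c : ℝ} (hc : 2 * (T : ℝ) - 1 + 2 * N ≤ c) :
    ((twoStage P orc Λ T T start).totalCalls ω : ℝ) ≤ c := by
  refine le_trans (le_of_eq ?_) hc
  rw [totalCalls_eq (a := twoStage P orc Λ T T start) hT ω]
  change (((T - 1 + N) + N + T : ℕ) : ℝ) = _
  push_cast [Nat.cast_sub hT]
  ring

end

theorem guarantee_mono {P : Problem N m} {a : P.Algo} {v e e' : ℝ} (h : a.Guarantee v e)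
    (he : e ≤ e') : a.Guarantee v e' :=
  ⟨h.1, fun xbar hx => ⟨(h.2 xbar hx).1,
    (h.2 xbar hx).2.1.trans (add_le_add_right (EReal.coe_le_coe_iff.2 he) _),
    (h.2 xbar hx).2.2.trans he⟩⟩

end SepOpt

open SepOpt.Problem.Algo in
theorem mainTheorem7 :
    -- constants depending on `G̃, H, ‖λ*‖, Λ`; the second also on an upper bound for `ε`,
    -- the last two (for arbitrary starting points) also on `N`
    ∃ (C : ℝ → ℝ → ℝ → ℝ → ℝ) (C' : ℝ → ℝ → ℝ → ℝ → ℝ → ℝ)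
      (B : ℕ → ℝ → ℝ → ℝ → ℝ → ℝ) (B' : ℕ → ℝ → ℝ → ℝ → ℝ → ℝ → ℝ),
    ∀ (N m : ℕ) (P : Problem N m), 0 < N → P.Admissible → BddAbove P.absValues →
    ∀ lamStar : Vec m, P.IsDualSolution lamStar → P.IsBidualValue (P.dual lamStar) →
    ∀ Λ : ℝ, 0 < Λ →
      -- start of the second stage from the first-stage averages
      (∀ orc, P.IsOracle orc → ∀ T K : ℕ, 1 ≤ T → 1 ≤ K →
        (twoStage P orc Λ T K .averages).Guarantee (P.dual lamStar)
          (C P.Gt P.H ‖lamStar‖ Λ * rate N T K)) ∧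
      (∀ ε₀ ε : ℝ, 0 < ε → ε ≤ ε₀ → ∃ T : ℕ, 1 ≤ T ∧ ∀ orc, P.IsOracle orc →
        (twoStage P orc Λ T T .averages).Guarantee (P.dual lamStar) ε ∧
        ∀ ω, ((twoStage P orc Λ T T .averages).totalCalls ω : ℝ) ≤
          C' ε₀ P.Gt P.H ‖lamStar‖ Λ * complexity N ε) ∧
      -- start of the second stage from arbitrary points at which `fᵢ` and `fᵢ**` agree
      (∀ orc, P.IsOracle orc → ∀ x0 : (i : Fin N) → Vec (P.dim i),
        (∀ i, x0 i ∈ dom (P.f i) ∧ P.f i (x0 i) = biconj (P.f i) (x0 i)) →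
        ∀ T K : ℕ, 1 ≤ T → 1 ≤ K →
        (twoStage P orc Λ T K (.points x0)).Guarantee (P.dual lamStar)
          (B N P.Gt P.H ‖lamStar‖ Λ * rate N T K)) ∧
      (∀ ε₀ ε : ℝ, 0 < ε → ε ≤ ε₀ → ∃ T : ℕ, 1 ≤ T ∧ ∀ orc, P.IsOracle orc →
        ∀ x0 : (i : Fin N) → Vec (P.dim i),
        (∀ i, x0 i ∈ dom (P.f i) ∧ P.f i (x0 i) = biconj (P.f i) (x0 i)) →
        (twoStage P orc Λ T T (.points x0)).Guarantee (P.dual lamStar) ε ∧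
        ∀ ω, ((twoStage P orc Λ T T (.points x0)).totalCalls ω : ℝ) ≤
          B' N ε₀ P.Gt P.H ‖lamStar‖ Λ * complexity N ε) := by
  refine ⟨averagesConst, fun ε₀ G H L Λ => complexityConst (averagesConst G H L Λ) ε₀, pointsConst,
    fun N ε₀ G H L Λ => complexityConst (pointsConst N G H L Λ) ε₀, ?_⟩
  intro N m P hN hP hH lamStar hs hv Λ hΛ
  have : NeZero N := ⟨hN.ne'⟩
  have hG := Problem.Gt_nonneg (P := P)
  have hH0 := Problem.H_nonneg (P := P)
  have g1 := gapConst_nonneg (L := ‖lamStar‖) hG hΛ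
  have g2 := startConst_nonneg (L := ‖lamStar‖) hG hH0 hΛ
  have hC : 0 ≤ averagesConst P.Gt P.H ‖lamStar‖ Λ := by unfold averagesConst; positivity
  have hB : 0 ≤ pointsConst N P.Gt P.H ‖lamStar‖ Λ := by unfold pointsConst; positivity
  refine ⟨fun orc ho T K hT hK => guarantee_twoStage_averages hP hH ho hs hv hΛ hT hK,
    fun ε₀ ε hε hε₀ => ?_,
    fun orc ho x0 hx0 T K hT hK => guarantee_twoStage_points hP hH ho hs hv hΛ hT hK hx0,
    fun ε₀ ε hε hε₀ => ?_⟩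
  · obtain ⟨T, hT, hrate, hcalls⟩ := exists_iterations N hC hε hε₀
    exact ⟨T, hT, fun orc ho =>
      ⟨guarantee_mono (guarantee_twoStage_averages hP hH ho hs hv hΛ hT hT) hrate,
        fun ω => totalCalls_twoStage_le hT _ ω hcalls⟩⟩
  · obtain ⟨T, hT, hrate, hcalls⟩ := exists_iterations N hB hε hε₀
    exact ⟨T, hT, fun orc ho x0 hx0 =>
      ⟨guarantee_mono (guarantee_twoStage_points hP hH ho hs hv hΛ hT hT hx0) hrate,
        fun ω => totalCalls_twoStage_le hT _ ω hcalls⟩⟩
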